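/- Let $n\ge 1$. For a random vector $\mathbf X$ in $\mathbb R^n$ (no moment assumption) and $\mathsf{snr}>0$ let $\mathbf Y=\sqrt{\mathsf{snr}}\,\mathbf X+\mathbf Z$, where $\mathbf Z\sim\mathcal N(\mathbf 0,\mathbf I)$ is independent of $\mathbf X$, and let $$\mathrm{mmse}(\mathbf X,\mathsf{snr})=\tfrac1n\mathrm{Tr}\,\mathbb E[\mathbf{Cov}(\mathbf X|\mathbf Y)],\qquad \mathbf{Cov}(\mathbf X|\mathbf Y)=\mathbb E\big[(\mathbf X-\mathbb E[\mathbf X|\mathbf Y])(\mathbf X-\mathbb E[\mathbf X|\mathbf Y])^{T}\,\big|\,\mathbf Y\big],$$ where the conditional expectations are integrals with respect to the regular conditional distribution of $\mathbf X$ given $\mathbf Y$; this depends only on the law of $\mathbf X$ and on $\mathsf{snr}$. **Theorem (D-bound).** For every $n\ge1$ there is a constant $k_n\le n+2$ such that the following holds for every random vector $\mathbf X$ in $\mathbb R^n$ and all $0<\mathsf{snr}\le\mathsf{snr}_0$. The quantities $\mathrm{mmse}(\mathbf X,\mathsf{snr})$ and $\mathrm{mmse}(\mathbf X,\mathsf{snr}_0)$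 are well defined and finite (all integrals in their definition converge). Write $\mathrm{mmse}(\mathbf X,\mathsf{snr}_0)=\frac{\beta}{1+\beta\,\mathsf{snr}_0}$ with $\beta\ge 0$. Then $$\mathrm{mmse}(\mathbf X,\mathsf{snr})\le \mathrm{mmse}(\mathbf X,\mathsf{snr}_0)+k_n\Big(\frac1{\mathsf{snr}}-\frac1{\mathsf{snr}_0}\Big)-\Delta$$ holds with $\Delta=0$. If in addition the second moments of $\mathbf X$ are finite and $\frac1n\mathrm{Tr}\,\mathbb E[\mathbf X\mathbf X^{T}]\le 1$, then it holds, with the same $k_n$, for $$\Delta=\int_{\mathsf{snr}}^{\mathsf{snr}_0}\frac{d\gamma}{\gamma^2(1+\gamma)^2} =2\log\frac{1+\mathsf{snr}_0}{1+\mathsf{snr}}-2\log\frac{\mathsf{snr}_0}{\mathsf{snr}}+\frac1{1+\mathsf{snr}}-\frac1{1+\mathsf{snr}_0}+\frac1{\mathsf{snr}}-\frac1{\mathsf{snr}_0}.$$ -/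

import Mathlib

open MeasureTheory ProbabilityTheory

noncomputable section

namespace DBound

variable {n : ℕ} {Ω : Type*} {mΩ : MeasurableSpace Ω}

/-- The conditional mean `E[X | Y = y]`: the mean of the regular conditional distribution of `X`
given `Y = y`. It makes sense without any moment assumption on `X` itself. -/
def condMean (X Y : Ω → EuclideanSpace ℝ (Fin n)) (μ : Measure Ω) [IsProbabilityMeasure μ]
    (y : EuclideanSpace ℝ (Fin n)) : EuclideanSpace ℝ (Fin n) :=
  ∫ x, x ∂(condDistrib X Y μ y)

/-- The conditional covariance matrix
`Cov(X | Y = y) = E[(X - E[X | Y = y]) (X - E[X | Y = y])ᵀ | Y = y]`. -/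
def condCov (X Y : Ω → EuclideanSpace ℝ (Fin n)) (μ : Measure Ω) [IsProbabilityMeasure μ]
    (y : EuclideanSpace ℝ (Fin n)) : Matrix (Fin n) (Fin n) ℝ :=
  Matrix.of fun i j =>
    ∫ x, (x i - condMean X Y μ y i) * (x j - condMean X Y μ y j) ∂(condDistrib X Y μ y)

/-- The (entrywise) expectation of a random matrix. -/
def expMatrix (A : Ω → Matrix (Fin n) (Fin n) ℝ) (μ : Measure Ω) : Matrix (Fin n) (Fin n) ℝ :=
  Matrix.of fun i j => ∫ ω, A ω i j ∂μ

/-- The minimum mean squared error of estimating `X` from `Y`, normalized by the dimension: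
`mmse(X | Y) = (1 / n) Tr E[Cov(X | Y)]`. -/
def mmse (X Y : Ω → EuclideanSpace ℝ (Fin n)) (μ : Measure Ω) [IsProbabilityMeasure μ] : ℝ :=
  (1 / (n : ℝ)) * (expMatrix (fun ω => condCov X Y μ (Y ω)) μ).trace

/-- All the integrals in the definition of `mmse X Y μ` converge: almost surely the conditional
law of `X` given `Y` has finite second moments, and `E[Cov(X | Y)]` is a convergent integral. -/
structure MmseWellDefined (X Y : Ω → EuclideanSpace ℝ (Fin n)) (μ : Measure Ω)
    [IsProbabilityMeasure μ] : Prop where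
  memLp_condDistrib : ∀ᵐ ω ∂μ, MemLp (fun x => x) 2 (condDistrib X Y μ (Y ω))
  integrable_condCov : ∀ i j, Integrable (fun ω => condCov X Y μ (Y ω) i j) μ

/-- The output `√snr X + Z` of the additive-noise channel with input `X` and noise `Z`. -/
def channelOutput (X Z : Ω → EuclideanSpace ℝ (Fin n)) (snr : ℝ) :
    Ω → EuclideanSpace ℝ (Fin n) :=
  fun ω => Real.sqrt snr • X ω + Z ω

/-- The power constraint `(1 / n) Tr E[X Xᵀ] ≤ 1`; that the second moments of `X` are finite is
part of it. -/
def PowerConstraint (X : Ω → EuclideanSpace ℝ (Fin n)) (μ : Measure Ω) : Prop :=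
  MemLp X 2 μ ∧
    (1 / (n : ℝ)) * (expMatrix (fun ω => Matrix.vecMulVec (X ω) (X ω)) μ).trace ≤ 1

end DBound

end

noncomputable section

namespace DBound

open scoped ENNReal Topology

/-! Write t = 1/snr for the noise variance and E(t) for the total mean squared error `errVar`. The
bound says that E(t)/n grows in t at rate at most n + 2, and at rate at most n + 2 - (t/(1+t))^2
under the power constraint; the substitution t = 1/γ turns the integral of (t/(1+t))^2 into Δ.

Rate of growth. Let c = 1/√t and Y = cX + Z. A slightly noisier output has the law of a multiple of
Y + sZ' with Z' fresh noise, and it may be estimated by the posterior mean m that is optimal for Y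
(`errVar_le_add_integral`). The excess error is the mean of ‖m(Y) - m(Y + sZ')‖^2. Since the
gradient of m is c·Cov(X|Y), this is s^2 c^2 E‖Cov(X|Y)‖_F^2 up to O(s^3) for a bounded input
(`errVar_step`), so E grows at rate at most c^4 E‖Cov(X|Y)‖_F^2, which is `covEnergy`. Only upper
bounds on increments are used, so E need not be differentiated; `le_of_increment_le` adds up the
small steps.

Bound on the rate. Given Y, the noise N = Y - cX has covariance c^2 Cov(X|Y). For any random vector
with mean a, ‖Cov‖_F^2 + ‖a‖^4 is at most the fourth moment (`sum_sq_cov_le`). Averaging over Y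
gives `covEnergy` ≤ E‖Z‖^4 - E‖E[N|Y]‖^4, where E‖Z‖^4 = n^2 + 2n. By Jensen the subtracted term is
at least (n - c^2 E(t))^2. Dropping it gives Δ = 0; under the power constraint linear estimation
gives n - c^2 E(t) ≥ n t/(1+t), hence Δ.

Unbounded inputs. The Gaussian likelihood makes all posterior moments finite whatever the prior, and
E for the truncated inputs converges to E by dominated convergence (`tendsto_errVar_map_trunc`), so
the bounds pass to the limit. -/

/-- The Euclidean space of dimension `n`. -/
abbrev Euc (n : ℕ) := EuclideanSpace ℝ (Fin n)

/-- The standard Gaussian measure on `ℝⁿ`. -/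
abbrev stdG (n : ℕ) : Measure (Euc n) := stdGaussian (Euc n)

variable {n : ℕ}

section GaussianMeasure

/-! ### Moments and shifts of the standard Gaussian measure -/

lemma integral_pow_four_gaussianReal : ∫ x : ℝ, x ^ 4 ∂(gaussianReal 0 1) = 3 := by
  have h := iteratedDeriv_mgf_zero (X := id) (μ := gaussianReal 0 1) (by simp) 4
  -- Differentiating p(t) exp(t^2/2) replaces the polynomial p by p' + tp. Four rounds from p = 1
  -- give t^4 + 6t^2 + 3, whose value at 0 is the fourth moment.
  have h1 : ∀ p q : ℝ → ℝ, (∀ t, HasDerivAt p (q t - p t * t) t) →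
      deriv (fun t : ℝ => p t * Real.exp (t ^ 2 / 2)) = fun t => q t * Real.exp (t ^ 2 / 2) := by
    intro p q hp
    funext t
    have h2 : HasDerivAt (fun t : ℝ => Real.exp (t ^ 2 / 2)) (Real.exp (t ^ 2 / 2) * t) t := by
      convert! (((hasDerivAt_id t).pow 2).div_const 2).exp using 1
      simp
    exact (((hp t).mul h2).congr_deriv (by ring)).deriv
  have h0 : mgf id (gaussianReal 0 1) = fun t => (fun _ => (1 : ℝ)) t * Real.exp (t ^ 2 / 2) := by
    rw [mgf_id_gaussianReal]
    simp
  rw [iteratedDeriv_succ', iteratedDeriv_succ', iteratedDeriv_succ', iteratedDeriv_succ',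
    iteratedDeriv_zero, h0, h1 _ (fun t => t), h1 _ (fun t => t ^ 2 + 1),
    h1 _ (fun t => t ^ 3 + 3 * t), h1 _ (fun t => t ^ 4 + 6 * t ^ 2 + 3)] at h
  · simpa using h.symm
  · intro t
    convert! ((hasDerivAt_id t).pow 3).add ((hasDerivAt_id t).const_mul 3) using 1
    simp; ring
  · intro t
    convert! ((hasDerivAt_id t).pow 2).add_const 1 using 1
    simp; ring
  · intro t
    convert! (hasDerivAt_id t) using 1
    ring
  · intro t
    convert! (hasDerivAt_const t (1 : ℝ)) using 1
    simp

lemma integral_sq_gaussianReal : ∫ x : ℝ, x ^ 2 ∂(gaussianReal 0 1) = 1 := by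
  have h := variance_fun_id_gaussianReal (μ := 0) (v := 1)
  rw [variance_of_integral_eq_zero (by fun_prop) (by simp)] at h
  simpa using h

lemma memLp_sq_gaussianReal : MemLp (fun x : ℝ => x ^ 2) 2 (gaussianReal 0 1) := by
  rw [memLp_two_iff_integrable_sq (by fun_prop)]
  have := (memLp_id_gaussianReal (μ := 0) (v := 1) 4).integrable_norm_pow (by simp)
  convert this using 2 with x
  rw [id, Real.norm_eq_abs, Even.pow_abs ⟨2, rfl⟩]
  ring

lemma memLp_stdG (p : ℝ≥0∞) (hp : p ≠ ∞) : MemLp (fun z : Euc n => z) p (stdG n) :=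
  IsGaussian.memLp_id _ p hp

lemma integrable_norm_pow_stdG (k : ℕ) : Integrable (fun z : Euc n => ‖z‖ ^ k) (stdG n) := by
  rcases Nat.eq_zero_or_pos k with rfl | hk
  · simp
  · exact (memLp_stdG k (by simp)).integrable_norm_pow hk.ne'

lemma map_pi_eq_stdG : (Measure.pi fun _ : Fin n => gaussianReal 0 1).map (WithLp.toLp 2) = stdG n :=
  map_pi_eq_stdGaussian

lemma integral_stdG_eq_pi {F : Type*} [NormedAddCommGroup F] [NormedSpace ℝ F] {f : Euc n → F}
    (hf : AEStronglyMeasurable f (stdG n)) :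
    ∫ z, f z ∂(stdG n) = ∫ x, f (WithLp.toLp 2 x) ∂(Measure.pi fun _ => gaussianReal 0 1) := by
  rw [← map_pi_eq_stdG] at hf ⊢
  rw [integral_map (by fun_prop) hf]

lemma integral_mul_coord_stdG (i j : Fin n) :
    ∫ z, z i * z j ∂(stdG n) = if i = j then 1 else 0 := by
  have h := covarianceBilin_apply_eq_cov (μ := stdG n) IsGaussian.memLp_two_id
    (EuclideanSpace.basisFun (Fin n) ℝ i) (EuclideanSpace.basisFun (Fin n) ℝ j)
  rw [covarianceBilin_stdGaussian] at h
  have h0 : ∀ i : Fin n, ∫ z, z i ∂(stdG n) = 0 := fun i => by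
    simpa using integral_strongDual_stdGaussian (EuclideanSpace.proj (𝕜 := ℝ) i : Euc n →L[ℝ] ℝ)
  have h1 : ∀ i : Fin n, (fun u : Euc n => inner ℝ (EuclideanSpace.basisFun (Fin n) ℝ i) u)
      = fun u => u i := by
    intro i; ext u; simp [PiLp.inner_apply]
  rw [h1, h1, covariance, h0, h0] at h
  simp only [sub_zero] at h
  rw [← h, innerSL_apply_apply]
  simp [PiLp.inner_apply, eq_comm]

lemma integrable_mul_coord_stdG (i j : Fin n) :
    Integrable (fun z : Euc n => z i * z j) (stdG n) := by
  refine (integrable_norm_pow_stdG 2).mono' (by fun_prop) (Filter.Eventually.of_forall fun z => ?_)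
  rw [norm_mul, sq]
  exact mul_le_mul (PiLp.norm_apply_le z i) (PiLp.norm_apply_le z j) (norm_nonneg _) (norm_nonneg _)

lemma integral_norm_sq_stdG : ∫ z, ‖z‖ ^ 2 ∂(stdG n) = n := by
  simp_rw [EuclideanSpace.real_norm_sq_eq, sq]
  rw [integral_finsetSum _ fun i _ => integrable_mul_coord_stdG i i]
  simp [integral_mul_coord_stdG]

/-- ‖z‖^2 is a sum of n independent squares, each of variance 3 - 1 = 2, so its second moment is n^2
+ 2n. Divided by n, this is the constant n + 2 of the theorem. -/
lemma integral_norm_pow_four_stdG : ∫ z, ‖z‖ ^ 4 ∂(stdG n) = (n : ℝ) ^ 2 + 2 * n := by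
  have hv := variance_sum_pi (ι := Fin n) (μ := fun _ => gaussianReal 0 1)
    (X := fun _ x => x ^ 2) (fun _ => memLp_sq_gaussianReal)
  have h1 : Var[fun x : ℝ => x ^ 2; gaussianReal 0 1] = 2 := by
    rw [variance_eq_sub memLp_sq_gaussianReal, integral_sq_gaussianReal]
    have : ∀ x : ℝ, (x ^ 2) ^ 2 = x ^ 4 := fun x => by ring
    simp only [Pi.pow_apply, this, integral_pow_four_gaussianReal]
    norm_num
  have h2 : (∑ i : Fin n, fun ω : Fin n → ℝ => ω i ^ 2)
      = fun ω => ‖(WithLp.toLp 2 ω : Euc n)‖ ^ 2 := by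
    ext ω; simp [EuclideanSpace.real_norm_sq_eq]
  have hm : MemLp (fun z : Euc n => ‖z‖ ^ 2) 2 (stdG n) := by
    rw [memLp_two_iff_integrable_sq (by fun_prop)]
    convert integrable_norm_pow_stdG (n := n) 4 using 2
    ring
  have h3 : Var[fun z : Euc n => ‖z‖ ^ 2; stdG n] = 2 * n := by
    rw [← map_pi_eq_stdG, variance_map (by fun_prop) (by fun_prop)]
    simp only [h1] at hv
    rw [h2] at hv
    simpa [Function.comp_def, mul_comm] using hv
  rw [variance_eq_sub hm, integral_norm_sq_stdG] at h3
  have : ∀ x : Euc n, (‖x‖ ^ 2) ^ 2 = ‖x‖ ^ 4 := fun x => by ring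
  simp only [Pi.pow_apply, this] at h3
  linarith

/-- The law of `Z + s Z'` for independent standard Gaussian vectors. -/
lemma map_add_smul_stdG (s : ℝ) :
    ((stdG n).prod (stdG n)).map (fun p => p.1 + s • p.2)
      = (stdG n).map (fun z => Real.sqrt (1 + s ^ 2) • z) := by
  apply Measure.ext_of_charFun
  ext t
  have e : ((stdG n).prod (stdG n)).map (fun p => p.1 + s • p.2)
      = (stdG n) ∗ ((stdG n).map (fun z => s • z)) := by
    have h := Measure.map_prod_map (stdG n) (stdG n) measurable_id
      (measurable_const_smul s : Measurable fun z : Euc n => s • z)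
    rw [Measure.map_id] at h
    rw [Measure.conv, h, Measure.map_map (by fun_prop) (by fun_prop)]
    rfl
  rw [e, charFun_conv, charFun_map_smul, charFun_map_smul]
  simp only [charFun_stdGaussian, ← Complex.exp_add]
  congr 1
  simp only [norm_smul, Real.norm_eq_abs, ← Complex.ofReal_pow, mul_pow, sq_abs]
  rw [Real.sq_sqrt (by positivity)]
  push_cast
  ring

/-- The density of a shifted standard Gaussian measure (Cameron-Martin). -/
lemma map_add_stdG (h : Euc n) :
    (stdG n).map (fun z => z + h)
      = (stdG n).withDensity
          (fun y => ENNReal.ofReal (Real.exp (inner ℝ h y - ‖h‖ ^ 2 / 2))) := by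
  -- Equality of characteristic functions: the integral factors over the coordinates into Gaussian
  -- moment generating functions at the complex points h_i + i t_i.
  have key : ∀ t : Euc n, ∫ y, Real.exp (inner ℝ h y - ‖h‖ ^ 2 / 2) •
      Complex.exp (inner ℝ y t * Complex.I) ∂(stdG n)
      = Complex.exp (-‖t‖ ^ 2 / 2) * Complex.exp (inner ℝ h t * Complex.I) := by
    intro t
    rw [integral_stdG_eq_pi (by fun_prop)]
    have e1 : ∀ x : Fin n → ℝ, Real.exp (inner ℝ h (WithLp.toLp 2 x : Euc n) - ‖h‖ ^ 2 / 2) •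
        Complex.exp (inner ℝ (WithLp.toLp 2 x : Euc n) t * Complex.I)
        = Complex.exp (-‖h‖ ^ 2 / 2) *
          ∏ i, Complex.exp ((h i + t i * Complex.I) * (x i : ℂ)) := by
      intro x
      rw [Complex.real_smul, Complex.ofReal_exp, ← Complex.exp_sum, ← Complex.exp_add,
        ← Complex.exp_add]
      congr 1
      simp only [PiLp.inner_apply, RCLike.inner_apply, conj_trivial]
      push_cast
      simp only [add_mul, Finset.sum_add_distrib, Finset.sum_mul]
      have : ∀ i, (t i : ℂ) * (x i : ℂ) * Complex.I = t i * Complex.I * x i := fun i => by ring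
      simp only [this, mul_comm (x _ : ℂ) (h _ : ℂ)]
      ring
    simp_rw [e1]
    rw [integral_const_mul, integral_fintype_prod_eq_prod
      (f := fun i (x : ℝ) => Complex.exp ((h i + t i * Complex.I) * (x : ℂ)))]
    have e2 : ∀ z : ℂ, ∫ x : ℝ, Complex.exp (z * (x : ℂ)) ∂(gaussianReal 0 1)
        = Complex.exp (z ^ 2 / 2) := by
      intro z
      simpa [complexMGF] using complexMGF_id_gaussianReal (μ := 0) (v := 1) z
    simp_rw [e2]
    rw [← Complex.exp_sum, ← Complex.exp_add, ← Complex.exp_add]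
    congr 1
    simp only [← Complex.ofReal_pow, EuclideanSpace.real_norm_sq_eq, PiLp.inner_apply,
      RCLike.inner_apply, conj_trivial]
    push_cast
    simp only [neg_div, Finset.sum_div, Finset.sum_mul, ← Finset.sum_neg_distrib,
      ← Finset.sum_add_distrib]
    refine Finset.sum_congr rfl fun i _ => ?_
    linear_combination (t i : ℂ) ^ 2 / 2 * Complex.I_sq
  have hfin : IsFiniteMeasure ((stdG n).withDensity
      (fun y => ENNReal.ofReal (Real.exp (inner ℝ h y - ‖h‖ ^ 2 / 2)))) := by
    refine isFiniteMeasure_withDensity_ofReal (Integrable.hasFiniteIntegral ?_)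
    -- Integrability of the density comes from `key` at t = 0: the integral of a non-integrable
    -- function is 0 by convention, whereas `key` gives 1.
    by_contra hc
    have k0 := key 0
    simp only [inner_zero_right, Complex.ofReal_zero, zero_mul, Complex.exp_zero,
      norm_zero, Complex.real_smul, mul_one] at k0
    rw [integral_complex_ofReal, integral_undef hc] at k0
    simp at k0
  apply Measure.ext_of_charFun
  ext t
  rw [charFun_map_add_const, charFun_stdGaussian, charFun_apply,
    integral_withDensity_eq_integral_toReal_smul (by fun_prop) (by simp)]
  simp_rw [ENNReal.toReal_ofReal (Real.exp_nonneg _)]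
  exact (key t).symm

end GaussianMeasure

section Posterior

/-! ### The posterior distribution in the Gaussian channel -/

/-- The likelihood ratio of the output `y` given the input `x`, with respect to pure noise. -/
def tilt (c : ℝ) (x y : Euc n) : ℝ := Real.exp (c * inner ℝ x y - c ^ 2 * ‖x‖ ^ 2 / 2)

lemma tilt_pos (c : ℝ) (x y : Euc n) : 0 < tilt c x y := Real.exp_pos _

lemma continuous_tilt (c : ℝ) : Continuous fun p : Euc n × Euc n => tilt c p.1 p.2 := by
  unfold tilt; fun_prop

lemma measurable_tilt_left (c : ℝ) (y : Euc n) : Measurable fun x : Euc n => tilt c x y := by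
  unfold tilt; fun_prop

lemma tilt_eq (c : ℝ) (x y : Euc n) :
    tilt c x y = Real.exp (‖y‖ ^ 2 / 2) * Real.exp (-‖y - c • x‖ ^ 2 / 2) := by
  rw [tilt, ← Real.exp_add, norm_sub_sq_real, inner_smul_right, norm_smul, real_inner_comm, mul_pow,
    Real.norm_eq_abs, sq_abs]
  congr 1
  ring

/-- For fixed y the likelihood is Gaussian in the noise y - c x, hence beats every power of it,
uniformly in x. This gives posterior moments without moments of the prior, and the dominating
constants for truncation. The constants come from t^k ≤ k! e^t and t - t^2/2 ≤ 1/2. -/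
lemma norm_pow_mul_tilt_le (k : ℕ) (c : ℝ) (x y : Euc n) :
    ‖y - c • x‖ ^ k * tilt c x y ≤ k.factorial * Real.exp (1 / 2) * Real.exp (‖y‖ ^ 2 / 2) := by
  rw [tilt_eq]
  set t := ‖y - c • x‖
  have ht : 0 ≤ t := norm_nonneg _
  have h1 : t ^ k ≤ k.factorial * Real.exp t := by
    have := Real.pow_div_factorial_le_exp t ht k
    rwa [div_le_iff₀' (by positivity)] at this
  have h2 : Real.exp t * Real.exp (-t ^ 2 / 2) ≤ Real.exp (1 / 2) := by
    rw [← Real.exp_add]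
    exact Real.exp_le_exp.2 (by nlinarith [sq_nonneg (t - 1)])
  calc t ^ k * (Real.exp (‖y‖ ^ 2 / 2) * Real.exp (-t ^ 2 / 2))
      ≤ (k.factorial * Real.exp t) * (Real.exp (‖y‖ ^ 2 / 2) * Real.exp (-t ^ 2 / 2)) := by gcongr
    _ = k.factorial * (Real.exp t * Real.exp (-t ^ 2 / 2)) * Real.exp (‖y‖ ^ 2 / 2) := by ring
    _ ≤ _ := by gcongr

lemma integrable_norm_pow_mul_tilt (ν : Measure (Euc n)) [IsFiniteMeasure ν] (k : ℕ) (c : ℝ)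
    (y : Euc n) : Integrable (fun x => ‖y - c • x‖ ^ k * tilt c x y) ν := by
  refine Integrable.of_bound (C := k.factorial * Real.exp (1 / 2) * Real.exp (‖y‖ ^ 2 / 2))
    ?_ (Filter.Eventually.of_forall fun x => ?_)
  · exact (Measurable.mul (by fun_prop) (measurable_tilt_left c y)).aestronglyMeasurable
  · rw [Real.norm_of_nonneg (mul_nonneg (by positivity) (tilt_pos c x y).le)]
    exact norm_pow_mul_tilt_le k c x y

lemma integrable_tilt (ν : Measure (Euc n)) [IsFiniteMeasure ν] (c : ℝ)
    (y : Euc n) : Integrable (fun x => tilt c x y) ν := by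
  simpa using integrable_norm_pow_mul_tilt ν 0 c y

/-- The density of the channel output with respect to pure noise. -/
def outDensity (ν : Measure (Euc n)) (c : ℝ) (y : Euc n) : ℝ := ∫ x, tilt c x y ∂ν

/-- The law of the channel output `c X + Z`. -/
def outLaw (ν : Measure (Euc n)) (c : ℝ) : Measure (Euc n) :=
  (ν.prod (stdG n)).map fun p => c • p.1 + p.2

lemma measurable_ofReal_tilt_div (ν : Measure (Euc n)) (c : ℝ) (y : Euc n) :
    Measurable fun x => ENNReal.ofReal (tilt c x y / outDensity ν c y) :=
  ENNReal.measurable_ofReal.comp ((measurable_tilt_left c y).div_const _)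

variable (ν : Measure (Euc n)) [IsProbabilityMeasure ν] (c : ℝ)

instance : IsProbabilityMeasure (outLaw ν c) :=
  Measure.isProbabilityMeasure_map (by fun_prop)

lemma outDensity_pos (y : Euc n) : 0 < outDensity ν c y := by
  rw [outDensity, integral_pos_iff_support_of_nonneg (fun x => (tilt_pos c x y).le)
    (integrable_tilt ν c y)]
  have : Function.support (fun x => tilt c x y) = Set.univ :=
    Set.eq_univ_of_forall fun x => (tilt_pos c x y).ne'
  rw [this]
  simp

lemma measurable_outDensity : Measurable (outDensity ν c) := by
  have h : StronglyMeasurable fun p : Euc n × Euc n => tilt c p.2 p.1 :=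
    ((continuous_tilt c).comp continuous_swap).stronglyMeasurable
  exact h.integral_prod_right.measurable

lemma measurable_tilt_div_outDensity : Measurable
    (Function.uncurry fun y x => ENNReal.ofReal (tilt c x y / outDensity ν c y)) := by
  refine ENNReal.measurable_ofReal.comp (Measurable.div ?_ ?_)
  · exact ((continuous_tilt c).comp continuous_swap).measurable
  · exact (measurable_outDensity ν c).comp measurable_fst

/-- The posterior distribution of the input `X ∼ ν` given the output `c X + Z = y`. -/
def posterior : Kernel (Euc n) (Euc n) :=
  Kernel.withDensity (Kernel.const (Euc n) ν)
    fun y x => ENNReal.ofReal (tilt c x y / outDensity ν c y)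

lemma posterior_apply (y : Euc n) :
    posterior ν c y = ν.withDensity fun x => ENNReal.ofReal (tilt c x y / outDensity ν c y) := by
  rw [posterior, Kernel.withDensity_apply _ (measurable_tilt_div_outDensity ν c)]
  simp

instance : IsMarkovKernel (posterior ν c) := by
  refine ⟨fun y => ⟨?_⟩⟩
  rw [posterior_apply, withDensity_apply _ MeasurableSet.univ, Measure.restrict_univ,
    ← ofReal_integral_eq_lintegral_ofReal ((integrable_tilt ν c y).div_const _)
      (Filter.Eventually.of_forall fun x => (div_pos (tilt_pos c x y) (outDensity_pos ν c y)).le),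
    integral_div]
  change ENNReal.ofReal (outDensity ν c y / outDensity ν c y) = 1
  rw [div_self (outDensity_pos ν c y).ne', ENNReal.ofReal_one]

lemma integral_posterior {F : Type*} [NormedAddCommGroup F] [NormedSpace ℝ F]
    (f : Euc n → F) (y : Euc n) :
    ∫ x, f x ∂(posterior ν c y) = (outDensity ν c y)⁻¹ • ∫ x, tilt c x y • f x ∂ν := by
  rw [posterior_apply, integral_withDensity_eq_integral_toReal_smul
    (measurable_ofReal_tilt_div ν c y) (by simp), ← integral_smul]
  congr 1 with x
  rw [ENNReal.toReal_ofReal (div_pos (tilt_pos c x y) (outDensity_pos ν c y)).le, smul_smul,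
    div_eq_inv_mul]

lemma integrable_posterior {F : Type*} [NormedAddCommGroup F] [NormedSpace ℝ F]
    {f : Euc n → F} {y : Euc n} (hf : Integrable (fun x => tilt c x y • f x) ν) :
    Integrable f (posterior ν c y) := by
  rw [posterior_apply, integrable_withDensity_iff_integrable_smul'
    (measurable_ofReal_tilt_div ν c y) (by simp)]
  have := hf.smul (outDensity ν c y)⁻¹
  refine this.congr (Filter.Eventually.of_forall fun x => ?_)
  simp only [Pi.smul_apply]
  rw [ENNReal.toReal_ofReal (div_pos (tilt_pos c x y) (outDensity_pos ν c y)).le, smul_smul,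
    div_eq_inv_mul]

lemma integrable_norm_pow_posterior (k : ℕ) (y : Euc n) :
    Integrable (fun x => ‖y - c • x‖ ^ k) (posterior ν c y) := by
  refine integrable_posterior ν c ?_
  simpa [mul_comm] using integrable_norm_pow_mul_tilt ν k c y

lemma memLp_noise_posterior (k : ℕ) (y : Euc n) :
    MemLp (fun x => y - c • x) k (posterior ν c y) := by
  rcases Nat.eq_zero_or_pos k with rfl | hk
  · simp only [Nat.cast_zero, memLp_zero_iff_aestronglyMeasurable]; fun_prop
  · rw [← integrable_norm_rpow_iff (by fun_prop) (by simp [hk.ne']) (by simp)]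
    simpa using integrable_norm_pow_posterior ν c k y

/-- The input is an affine function of the noise once y is fixed and c ≠ 0, so it inherits the
moments of the noise. -/
lemma memLp_posterior {c : ℝ} (hc : c ≠ 0) (k : ℕ) (y : Euc n) :
    MemLp (fun x => x) k (posterior ν c y) := by
  have h := ((memLp_const y).sub (memLp_noise_posterior ν c k y)).const_smul c⁻¹
  refine h.congr_norm (by fun_prop) (Filter.Eventually.of_forall fun x => ?_)
  simp [smul_smul, inv_mul_cancel₀ hc]

/-- Tonelli and Cameron-Martin: given x, the output is a standard Gaussian shifted by c x, with
density `tilt c x`. Both the output density and Bayes' rule follow by choice of F. -/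
lemma lintegral_channel {F : Euc n → Euc n → ℝ≥0∞} (hF : Measurable (Function.uncurry F)) :
    ∫⁻ p, F (c • p.1 + p.2) p.1 ∂(ν.prod (stdG n))
      = ∫⁻ y, ∫⁻ x, F y x * ENNReal.ofReal (tilt c x y) ∂ν ∂(stdG n) := by
  have hF1 : ∀ x, Measurable fun y => F y x := fun x => hF.comp measurable_prodMk_right
  have ht : Measurable fun p : Euc n × Euc n => ENNReal.ofReal (tilt c p.1 p.2) :=
    ENNReal.measurable_ofReal.comp (continuous_tilt c).measurable
  have hm : Measurable fun p : Euc n × Euc n => F (c • p.1 + p.2) p.1 :=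
    hF.comp (show Measurable fun p : Euc n × Euc n => (c • p.1 + p.2, p.1) by fun_prop)
  rw [lintegral_prod _ hm.aemeasurable]
  symm
  rw [lintegral_lintegral_swap]
  symm
  · refine lintegral_congr fun x => ?_
    have h1 : ∫⁻ z, F (c • x + z) x ∂(stdG n)
        = ∫⁻ y, F y x ∂((stdG n).map (fun z => z + c • x)) := by
      rw [lintegral_map (hF1 x) (by fun_prop)]
      simp_rw [add_comm]
    rw [h1, map_add_stdG, lintegral_withDensity_eq_lintegral_mul _ (by fun_prop) (hF1 x)]
    refine lintegral_congr fun y => ?_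
    rw [Pi.mul_apply, mul_comm, tilt, inner_smul_left, norm_smul, mul_pow, Real.norm_eq_abs, sq_abs]
    simp
  · exact ((hF.mul (ht.comp measurable_swap))).aemeasurable

lemma outLaw_eq_withDensity :
    outLaw ν c = (stdG n).withDensity fun y => ENNReal.ofReal (outDensity ν c y) := by
  refine Measure.ext_of_lintegral _ fun f hf => ?_
  have hP := (measurable_outDensity ν c).ennreal_ofReal
  rw [outLaw, lintegral_map hf (by fun_prop),
    lintegral_channel ν c (F := fun y _ => f y) (hf.comp measurable_fst),
    lintegral_withDensity_eq_lintegral_mul _ hP hf]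
  refine lintegral_congr fun y => ?_
  rw [lintegral_const_mul _ (measurable_tilt_left c y).ennreal_ofReal, Pi.mul_apply, mul_comm,
    outDensity, ofReal_integral_eq_lintegral_ofReal (integrable_tilt ν c y)
      (Filter.Eventually.of_forall fun x => (tilt_pos c x y).le)]

/-- Bayes' rule: disintegration of the joint law of output and input. -/
lemma outLaw_compProd_posterior :
    outLaw ν c ⊗ₘ posterior ν c = (ν.prod (stdG n)).map fun p => (c • p.1 + p.2, p.1) := by
  refine Measure.ext_of_lintegral _ fun f hf => ?_
  have hP := (measurable_outDensity ν c).ennreal_ofReal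
  rw [lintegral_map hf (by fun_prop), Measure.lintegral_compProd hf,
    lintegral_channel ν c (F := fun y x => f (y, x)) hf, outLaw_eq_withDensity,
    lintegral_withDensity_eq_lintegral_mul _ hP hf.lintegral_kernel_prod_right']
  refine lintegral_congr fun y => ?_
  have hfy : Measurable fun x => f (y, x) := hf.comp measurable_prodMk_left
  rw [Pi.mul_apply, posterior_apply, lintegral_withDensity_eq_lintegral_mul _
    (measurable_ofReal_tilt_div ν c y) hfy, ← lintegral_const_mul _
    ((measurable_ofReal_tilt_div ν c y).mul hfy)]
  refine lintegral_congr fun x => ?_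
  rw [Pi.mul_apply, ← mul_assoc, ← ENNReal.ofReal_mul (outDensity_pos ν c y).le,
    mul_div_cancel₀ _ (outDensity_pos ν c y).ne', mul_comm]

variable {ν c}

lemma integrable_compProd_posterior {F : Type*} [NormedAddCommGroup F]
    {f : Euc n × Euc n → F} (hm : StronglyMeasurable f)
    (hf : Integrable (fun p : Euc n × Euc n => f (c • p.1 + p.2, p.1)) (ν.prod (stdG n))) :
    Integrable f (outLaw ν c ⊗ₘ posterior ν c) := by
  rw [outLaw_compProd_posterior, integrable_map_measure hm.aestronglyMeasurable (by fun_prop)]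
  exact hf

/-- The tower property. For f depending on y - c x alone, it reduces posterior averages to moments
of the standard Gaussian. -/
lemma integral_posterior_outLaw {F : Type*} [NormedAddCommGroup F] [NormedSpace ℝ F]
    {f : Euc n × Euc n → F} (hm : StronglyMeasurable f)
    (hf : Integrable (fun p : Euc n × Euc n => f (c • p.1 + p.2, p.1)) (ν.prod (stdG n))) :
    ∫ y, ∫ x, f (y, x) ∂(posterior ν c y) ∂(outLaw ν c)
      = ∫ p, f (c • p.1 + p.2, p.1) ∂(ν.prod (stdG n)) := by
  rw [← Measure.integral_compProd (integrable_compProd_posterior hm hf),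
    outLaw_compProd_posterior, integral_map (by fun_prop) hm.aestronglyMeasurable]

lemma integrable_integral_posterior {F : Type*} [NormedAddCommGroup F] [NormedSpace ℝ F]
    {f : Euc n × Euc n → F} (hm : StronglyMeasurable f)
    (hf : Integrable (fun p : Euc n × Euc n => f (c • p.1 + p.2, p.1)) (ν.prod (stdG n))) :
    Integrable (fun y => ∫ x, f (y, x) ∂(posterior ν c y)) (outLaw ν c) :=
  Integrable.integral_compProd (integrable_compProd_posterior hm hf)

end Posterior

section ErrorVariance

/-! ### Mean and covariance of a random vector -/

lemma integral_coord {α : Type*} {mα : MeasurableSpace α} {π : Measure α}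
    {z : α → Euc n} (hz : Integrable z π) (i : Fin n) :
    (∫ ω, z ω ∂π) i = ∫ ω, z ω i ∂π :=
  ((EuclideanSpace.proj (𝕜 := ℝ) i : Euc n →L[ℝ] ℝ).integral_comp_comm hz).symm

section Moments

variable {α : Type*} {mα : MeasurableSpace α} {π : Measure α} [IsProbabilityMeasure π]

/-- The bias-variance decomposition. It shows that the posterior mean is optimal and gives the exact
cost of any other estimator. -/
lemma integral_norm_sub_sq {z : α → Euc n} (hz : MemLp z 2 π) (a : Euc n) :
    ∫ ω, ‖z ω - a‖ ^ 2 ∂π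
      = ∫ ω, ‖z ω - ∫ ω, z ω ∂π‖ ^ 2 ∂π + ‖(∫ ω, z ω ∂π) - a‖ ^ 2 := by
  set m := ∫ ω, z ω ∂π
  have hi : Integrable (fun ω => z ω - m) π := (hz.integrable one_le_two).sub (integrable_const m)
  have h1 : ∀ ω, ‖z ω - a‖ ^ 2 = ‖z ω - m‖ ^ 2 + (2 * inner ℝ (m - a) (z ω - m) + ‖m - a‖ ^ 2) := by
    intro ω
    rw [← sub_add_sub_cancel (z ω) m a, norm_add_sq_real, real_inner_comm]
    ring
  have h2 : Integrable (fun ω => ‖z ω - m‖ ^ 2) π :=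
    (hz.sub (memLp_const m)).integrable_norm_pow two_ne_zero
  have h3 : Integrable (fun ω => 2 * inner ℝ (m - a) (z ω - m)) π := (hi.const_inner _).const_mul 2
  simp_rw [h1]
  rw [integral_add h2 (h3.fun_add (integrable_const _)), integral_add h3 (integrable_const _),
    integral_const_mul, integral_inner hi, integral_sub (hz.integrable one_le_two)
    (integrable_const m)]
  simp [m]

lemma integral_norm_sub_integral_sq {z : α → Euc n} (hz : MemLp z 2 π) :
    ∫ ω, ‖z ω - ∫ ω, z ω ∂π‖ ^ 2 ∂π = ∫ ω, ‖z ω‖ ^ 2 ∂π - ‖∫ ω, z ω ∂π‖ ^ 2 := by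
  have := integral_norm_sub_sq hz 0
  simp only [sub_zero] at this
  linarith

lemma sq_integral_le {f : α → ℝ} (hf : MemLp f 2 π) : (∫ ω, f ω ∂π) ^ 2 ≤ ∫ ω, f ω ^ 2 ∂π := by
  have h := variance_nonneg f π
  rw [variance_eq_sub hf] at h
  simpa using h

lemma integrable_mul_coord {z : α → Euc n} (hz : MemLp z 2 π) (a : Euc n) (i j : Fin n) :
    Integrable (fun ω => (z ω i - a i) * (z ω j - a j)) π := by
  have h : ∀ i, MemLp (fun ω => z ω i - a i) 2 π := fun i =>
    (((EuclideanSpace.proj (𝕜 := ℝ) i : Euc n →L[ℝ] ℝ).comp_memLp' (hz.sub (memLp_const a))))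
  exact (h i).integrable_mul (h j)

/-- With A = C + m mᵀ the second moment matrix, Jensen applied to each entry gives ‖A‖_F^2 ≤ E‖z‖^4.
Expanding, ‖A‖_F^2 = ‖C‖_F^2 + 2 mᵀCm + ‖m‖^4, and the cross term is nonnegative because C is a
covariance matrix. -/
lemma sum_sq_cov_le {z : α → Euc n} (hz : MemLp z 4 π) :
    ∑ i, ∑ j, (∫ ω, (z ω i - (∫ ω, z ω ∂π) i) * (z ω j - (∫ ω, z ω ∂π) j) ∂π) ^ 2
      + ‖∫ ω, z ω ∂π‖ ^ 4 ≤ ∫ ω, ‖z ω‖ ^ 4 ∂π := by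
  have hz2 : MemLp z 2 π := hz.mono_exponent (by norm_num)
  have hz1 : Integrable z π := hz2.integrable one_le_two
  set m := ∫ ω, z ω ∂π with hm
  have hm' : ∀ i, ∫ ω, z ω i ∂π = m i := fun i => (integral_coord hz1 i).symm
  have hzi : ∀ i, Integrable (fun ω => z ω i) π := fun i =>
    (EuclideanSpace.proj (𝕜 := ℝ) i : Euc n →L[ℝ] ℝ).integrable_comp hz1
  have hzz : ∀ i j, Integrable (fun ω => z ω i * z ω j) π := fun i j => by
    simpa using integrable_mul_coord hz2 0 i j
  set A : Fin n → Fin n → ℝ := fun i j => ∫ ω, z ω i * z ω j ∂π with hA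
  set C : Fin n → Fin n → ℝ := fun i j => ∫ ω, (z ω i - m i) * (z ω j - m j) ∂π with hC
  have hAC : ∀ i j, A i j = C i j + m i * m j := by
    intro i j
    have : ∀ ω, (z ω i - m i) * (z ω j - m j)
        = z ω i * z ω j - (m j * z ω i + (m i * z ω j - m i * m j)) := fun ω => by ring
    simp only [hC, hA, this]
    have i1 : Integrable (fun ω => m i * z ω j - m i * m j) π :=
      ((hzi j).const_mul _).sub (integrable_const _)
    rw [integral_sub (hzz i j) (((hzi i).const_mul _).fun_add i1),
      integral_add ((hzi i).const_mul _) i1, integral_sub ((hzi j).const_mul _)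
      (integrable_const _), integral_const_mul, integral_const_mul, hm', hm']
    simp
    ring
  have hmem : ∀ i j, MemLp (fun ω => z ω i * z ω j) 2 π := by
    intro i j
    rw [memLp_two_iff_integrable_sq (hzz i j).1]
    refine (hz.integrable_norm_pow (by norm_num : (4 : ℕ) ≠ 0)).mono' ((hzz i j).1.pow 2)
      (Filter.Eventually.of_forall fun ω => ?_)
    rw [norm_pow, norm_mul, mul_pow]
    calc ‖z ω i‖ ^ 2 * ‖z ω j‖ ^ 2 ≤ ‖z ω‖ ^ 2 * ‖z ω‖ ^ 2 := by
          gcongr <;> exact PiLp.norm_apply_le _ _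
      _ = ‖z ω‖ ^ 4 := by ring
  have hA2 : ∑ i, ∑ j, A i j ^ 2 ≤ ∫ ω, ‖z ω‖ ^ 4 ∂π := by
    calc ∑ i, ∑ j, A i j ^ 2 ≤ ∑ i, ∑ j, ∫ ω, (z ω i * z ω j) ^ 2 ∂π :=
          Finset.sum_le_sum fun i _ => Finset.sum_le_sum fun j _ => sq_integral_le (hmem i j)
      _ = ∫ ω, ‖z ω‖ ^ 4 ∂π := by
          simp_rw [← integral_finsetSum Finset.univ fun j _ => (hmem _ j).integrable_sq]
          rw [← integral_finsetSum Finset.univ fun i _ => integrable_finsetSum _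
            fun j _ => (hmem i j).integrable_sq]
          refine integral_congr_ae (Filter.Eventually.of_forall fun ω => ?_)
          simp only
          rw [show ‖z ω‖ ^ 4 = ‖z ω‖ ^ 2 * ‖z ω‖ ^ 2 by ring, EuclideanSpace.real_norm_sq_eq,
            Finset.sum_mul_sum]
          simp [mul_pow]
  -- mᵀCm is the mean of the square of ⟨z - m, m⟩.
  have hpos : 0 ≤ ∑ i, ∑ j, C i j * (m i * m j) := by
    have : ∑ i, ∑ j, C i j * (m i * m j) = ∫ ω, (∑ i, (z ω i - m i) * m i) ^ 2 ∂π := by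
      simp_rw [hC, ← integral_mul_const]
      simp_rw [← integral_finsetSum Finset.univ fun j _ =>
        ((integrable_mul_coord hz2 m _ j).mul_const _)]
      rw [← integral_finsetSum Finset.univ fun i _ => integrable_finsetSum _
            fun j _ => ((integrable_mul_coord hz2 m i j).mul_const _)]
      refine integral_congr_ae (Filter.Eventually.of_forall fun ω => ?_)
      simp only
      rw [sq, Finset.sum_mul_sum]
      refine Finset.sum_congr rfl fun i _ => Finset.sum_congr rfl fun j _ => by ring
    rw [this]
    exact integral_nonneg fun ω => sq_nonneg _
  have hmm : ‖m‖ ^ 4 = ∑ i, ∑ j, (m i * m j) ^ 2 := by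
    rw [show ‖m‖ ^ 4 = ‖m‖ ^ 2 * ‖m‖ ^ 2 by ring, EuclideanSpace.real_norm_sq_eq,
            Finset.sum_mul_sum]
    simp [mul_pow]
  have hexp : ∑ i, ∑ j, A i j ^ 2 = ∑ i, ∑ j, C i j ^ 2 + 2 * ∑ i, ∑ j, C i j * (m i * m j)
      + ∑ i, ∑ j, (m i * m j) ^ 2 := by
    simp_rw [hAC, Finset.mul_sum, ← Finset.sum_add_distrib]
    refine Finset.sum_congr rfl fun i _ => Finset.sum_congr rfl fun j _ => by ring
  rw [hmm]
  change ∑ i, ∑ j, C i j ^ 2 + _ ≤ _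
  linarith

end Moments

/-! ### The error variance -/

/-- The posterior mean `E[X | c X + Z = y]`. -/
def postMean (ν : Measure (Euc n)) [IsProbabilityMeasure ν] (c : ℝ) (y : Euc n) : Euc n :=
  ∫ x, x ∂(posterior ν c y)

/-- The entries of the posterior covariance matrix `Cov(X | c X + Z = y)`. -/
def postCov (ν : Measure (Euc n)) [IsProbabilityMeasure ν] (c : ℝ) (y : Euc n) (i j : Fin n) : ℝ :=
  ∫ x, (x i - postMean ν c y i) * (x j - postMean ν c y j) ∂(posterior ν c y)

/-- The trace of the posterior covariance matrix. -/
def postVar (ν : Measure (Euc n)) [IsProbabilityMeasure ν] (c : ℝ) (y : Euc n) : ℝ :=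
  ∫ x, ‖x - postMean ν c y‖ ^ 2 ∂(posterior ν c y)

/-- The total mean squared error of the estimation of `X ∼ ν` from `c X + Z`. -/
def errVar (ν : Measure (Euc n)) [IsProbabilityMeasure ν] (c : ℝ) : ℝ :=
  ∫ y, postVar ν c y ∂(outLaw ν c)

variable {ν : Measure (Euc n)} [IsProbabilityMeasure ν] {c : ℝ}

lemma stronglyMeasurable_postMean (ν : Measure (Euc n)) [IsProbabilityMeasure ν] (c : ℝ) :
    StronglyMeasurable (postMean ν c) :=
  StronglyMeasurable.integral_kernel_prod_right' (κ := posterior ν c) (f := Prod.snd)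
    measurable_snd.stronglyMeasurable

lemma measurable_postMean (ν : Measure (Euc n)) [IsProbabilityMeasure ν] (c : ℝ) :
    Measurable (postMean ν c) := (stronglyMeasurable_postMean ν c).measurable

lemma stronglyMeasurable_postCov (ν : Measure (Euc n)) [IsProbabilityMeasure ν] (c : ℝ)
    (i j : Fin n) : StronglyMeasurable fun y => postCov ν c y i j := by
  refine StronglyMeasurable.integral_kernel_prod_right' (κ := posterior ν c)
    (f := fun p => (p.2 i - postMean ν c p.1 i) * (p.2 j - postMean ν c p.1 j))
    (Measurable.stronglyMeasurable ?_)
  have : Measurable fun p : Euc n × Euc n => postMean ν c p.1 :=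
    (measurable_postMean ν c).comp measurable_fst
  have h : ∀ i, Measurable fun p : Euc n × Euc n => p.2 i - postMean ν c p.1 i := fun i =>
    (by fun_prop : Measurable fun v : Euc n => v i).comp (measurable_snd.sub this)
  exact (h i).mul (h j)

lemma postVar_eq_sum (hc : c ≠ 0) (y : Euc n) : postVar ν c y = ∑ i, postCov ν c y i i := by
  simp_rw [postVar, postCov]
  rw [← integral_finsetSum Finset.univ fun i _ =>
    integrable_mul_coord (memLp_posterior ν hc 2 y) _ i i]
  simp_rw [EuclideanSpace.real_norm_sq_eq, sq, PiLp.sub_apply]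

lemma postVar_nonneg (y : Euc n) : 0 ≤ postVar ν c y := integral_nonneg fun _ => by positivity

lemma abs_postCov_le (hc : c ≠ 0) (y : Euc n) (i j : Fin n) :
    |postCov ν c y i j| ≤ postVar ν c y := by
  refine (abs_integral_le_integral_abs).trans (integral_mono_of_nonneg
    (Filter.Eventually.of_forall fun x => abs_nonneg _) ?_ (Filter.Eventually.of_forall fun x => ?_))
  · exact ((memLp_posterior ν hc 2 y).sub (memLp_const _)).integrable_norm_pow two_ne_zero
  · simp only
    rw [abs_mul, sq]
    have h := fun i => PiLp.norm_apply_le (x - postMean ν c y) i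
    exact mul_le_mul (h i) (h j) (abs_nonneg _) (norm_nonneg _)

lemma integral_noise (hc : c ≠ 0) (y : Euc n) :
    ∫ x, (y - c • x) ∂(posterior ν c y) = y - c • postMean ν c y := by
  have h := (memLp_posterior ν hc 1 y).integrable (by simp)
  rw [integral_sub (integrable_const y) (h.fun_smul c), integral_smul]
  simp [postMean]

/-- Given the output y, the noise y - c x and -c x differ by a constant, so c^2 times the posterior
variance of the input is that of the noise. -/
lemma sq_mul_postVar (hc : c ≠ 0) (y : Euc n) :
    c ^ 2 * postVar ν c y
      = ∫ x, ‖y - c • x‖ ^ 2 ∂(posterior ν c y) - ‖y - c • postMean ν c y‖ ^ 2 := by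
  rw [← integral_noise hc, ← integral_norm_sub_integral_sq (memLp_noise_posterior ν c 2 y),
    integral_noise hc, postVar, ← integral_const_mul]
  congr 1 with x
  rw [show y - c • x - (y - c • postMean ν c y) = -(c • (x - postMean ν c y)) by
    rw [smul_sub]; abel, norm_neg, norm_smul, mul_pow, Real.norm_eq_abs, sq_abs]

lemma sum_sq_postCov_le (hc : c ≠ 0) (y : Euc n) :
    c ^ 4 * ∑ i, ∑ j, postCov ν c y i j ^ 2 + ‖y - c • postMean ν c y‖ ^ 4
      ≤ ∫ x, ‖y - c • x‖ ^ 4 ∂(posterior ν c y) := by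
  have h := sum_sq_cov_le (memLp_noise_posterior ν c 4 y)
  rw [integral_noise hc] at h
  convert h using 2
  rw [Finset.mul_sum]
  refine Finset.sum_congr rfl fun i _ => ?_
  rw [Finset.mul_sum]
  refine Finset.sum_congr rfl fun j _ => ?_
  rw [show c ^ 4 * postCov ν c y i j ^ 2 = (c ^ 2 * postCov ν c y i j) ^ 2 by ring, postCov,
    ← integral_const_mul]
  congr 2 with x
  simp
  ring

lemma integrable_noise_pow (ν : Measure (Euc n)) [IsProbabilityMeasure ν] (k : ℕ) :
    Integrable (fun p : Euc n × Euc n => ‖c • p.1 + p.2 - c • p.1‖ ^ k) (ν.prod (stdG n)) := by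
  simp only [add_sub_cancel_left]
  exact (integrable_norm_pow_stdG k).comp_snd ν

lemma stronglyMeasurable_noise_pow (k : ℕ) :
    StronglyMeasurable fun p : Euc n × Euc n => ‖p.1 - c • p.2‖ ^ k :=
  Measurable.stronglyMeasurable (by fun_prop)

lemma integral_noise_pow (ν : Measure (Euc n)) [IsProbabilityMeasure ν] (c : ℝ) (k : ℕ) :
    ∫ y, ∫ x, ‖y - c • x‖ ^ k ∂(posterior ν c y) ∂(outLaw ν c) = ∫ z, ‖z‖ ^ k ∂(stdG n) := by
  rw [integral_posterior_outLaw (stronglyMeasurable_noise_pow k) (integrable_noise_pow ν k)]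
  simp only [add_sub_cancel_left]
  rw [integral_fun_snd (fun z : Euc n => ‖z‖ ^ k)]
  simp

lemma integrable_integral_noise_pow (ν : Measure (Euc n)) [IsProbabilityMeasure ν] (c : ℝ) (k : ℕ) :
    Integrable (fun y => ∫ x, ‖y - c • x‖ ^ k ∂(posterior ν c y)) (outLaw ν c) :=
  integrable_integral_posterior (stronglyMeasurable_noise_pow k) (integrable_noise_pow ν k)

lemma measurable_noiseMean (ν : Measure (Euc n)) [IsProbabilityMeasure ν] (c : ℝ) :
    Measurable fun y => y - c • postMean ν c y :=
  measurable_id.sub ((measurable_postMean ν c).const_smul c)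

lemma integrable_noiseMean_sq (hc : c ≠ 0) :
    Integrable (fun y => ‖y - c • postMean ν c y‖ ^ 2) (outLaw ν c) := by
  refine (integrable_integral_noise_pow ν c 2).mono'
    ((measurable_noiseMean ν c).norm.pow_const 2).aestronglyMeasurable
    (Filter.Eventually.of_forall fun y => ?_)
  rw [Real.norm_of_nonneg (by positivity)]
  have := mul_nonneg (sq_nonneg c) (postVar_nonneg (ν := ν) (c := c) y)
  rw [sq_mul_postVar hc] at this
  linarith

lemma integrable_postVar (hc : c ≠ 0) : Integrable (postVar ν c) (outLaw ν c) := by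
  have h := ((integrable_integral_noise_pow ν c 2).sub (integrable_noiseMean_sq hc)).const_mul
    (c ^ 2)⁻¹
  refine h.congr (Filter.Eventually.of_forall fun y => ?_)
  simp only [Pi.sub_apply]
  rw [← sq_mul_postVar hc, inv_mul_cancel_left₀ (pow_ne_zero 2 hc)]

lemma integrable_postCov (hc : c ≠ 0) (i j : Fin n) :
    Integrable (fun y => postCov ν c y i j) (outLaw ν c) :=
  (integrable_postVar hc).mono' (stronglyMeasurable_postCov ν c i j).aestronglyMeasurable
    (Filter.Eventually.of_forall fun y => abs_postCov_le hc y i j)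

/-- The error variance in terms of the conditional mean of the noise. -/
lemma sq_mul_errVar (hc : c ≠ 0) :
    c ^ 2 * errVar ν c = n - ∫ y, ‖y - c • postMean ν c y‖ ^ 2 ∂(outLaw ν c) := by
  rw [errVar, ← integral_const_mul]
  simp_rw [sq_mul_postVar hc]
  rw [integral_sub (integrable_integral_noise_pow ν c 2) (integrable_noiseMean_sq hc),
    integral_noise_pow, integral_norm_sq_stdG]

lemma integrable_noiseMean_pow_four (hc : c ≠ 0) :
    Integrable (fun y => ‖y - c • postMean ν c y‖ ^ 4) (outLaw ν c) := by
  refine (integrable_integral_noise_pow ν c 4).mono'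
    ((measurable_noiseMean ν c).norm.pow_const 4).aestronglyMeasurable
    (Filter.Eventually.of_forall fun y => ?_)
  rw [Real.norm_of_nonneg (by positivity)]
  have := sum_sq_postCov_le (ν := ν) hc y
  have h2 : 0 ≤ c ^ 4 * ∑ i, ∑ j, postCov ν c y i j ^ 2 :=
    mul_nonneg (by positivity) (Finset.sum_nonneg fun i _ => Finset.sum_nonneg fun j _ => sq_nonneg _)
  linarith

lemma integrable_sum_sq_postCov (hc : c ≠ 0) :
    Integrable (fun y => ∑ i, ∑ j, postCov ν c y i j ^ 2) (outLaw ν c) := by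
  refine ((integrable_integral_noise_pow ν c 4).const_mul (c ^ 4)⁻¹).mono'
    ?_ (Filter.Eventually.of_forall fun y => ?_)
  · exact (Finset.measurable_sum _ fun i _ => Finset.measurable_sum _ fun j _ =>
      (stronglyMeasurable_postCov ν c i j).measurable.pow_const 2).aestronglyMeasurable
  · rw [Real.norm_of_nonneg
      (Finset.sum_nonneg fun i _ => Finset.sum_nonneg fun j _ => sq_nonneg _)]
    have := sum_sq_postCov_le (ν := ν) hc y
    have hc4 : 0 < c ^ 4 := by positivity
    rw [inv_mul_eq_div, le_div_iff₀' hc4]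
    have : 0 ≤ ‖y - c • postMean ν c y‖ ^ 4 := by positivity
    linarith

/-- The mean of the squared Frobenius norm of the posterior covariance matrix is bounded by the
fourth moment of the noise. -/
lemma integral_sum_sq_postCov_le (hc : c ≠ 0) :
    c ^ 4 * ∫ y, ∑ i, ∑ j, postCov ν c y i j ^ 2 ∂(outLaw ν c)
      ≤ (n : ℝ) ^ 2 + 2 * n - (n - c ^ 2 * errVar ν c) ^ 2 := by
  have h1 := integral_mono (((integrable_sum_sq_postCov hc).const_mul (c ^ 4)).add
    (integrable_noiseMean_pow_four (ν := ν) hc)) (integrable_integral_noise_pow ν c 4)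
    (fun y => sum_sq_postCov_le hc y)
  simp only [Pi.add_apply] at h1
  rw [integral_add ((integrable_sum_sq_postCov hc).const_mul (c ^ 4))
    (integrable_noiseMean_pow_four hc), integral_const_mul, integral_noise_pow,
    integral_norm_pow_four_stdG] at h1
  have h2 : MemLp (fun y => ‖y - c • postMean ν c y‖ ^ 2) 2 (outLaw ν c) := by
    rw [memLp_two_iff_integrable_sq (integrable_noiseMean_sq hc).1]
    convert integrable_noiseMean_pow_four (ν := ν) hc using 2
    ring
  -- Jensen over the output: the fourth power of the conditional noise mean is at least the square
  -- of its mean square n - c^2 `errVar ν c`. This retained term is the source of Δ.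
  have h3 := sq_integral_le h2
  rw [sq_mul_errVar hc]
  have : ∀ y, (‖y - c • postMean ν c y‖ ^ 2) ^ 2 = ‖y - c • postMean ν c y‖ ^ 4 := fun y => by ring
  simp only [this] at h3
  rw [sub_sub_cancel]
  linarith

/-- The posterior mean is the best estimator in mean square. -/
lemma errVar_le (hc : c ≠ 0) {f : Euc n → Euc n} (hf : Measurable f)
    (hi : Integrable (fun p : Euc n × Euc n => ‖p.1 - f (c • p.1 + p.2)‖ ^ 2) (ν.prod (stdG n))) :
    errVar ν c ≤ ∫ p, ‖p.1 - f (c • p.1 + p.2)‖ ^ 2 ∂(ν.prod (stdG n)) := by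
  have hm : StronglyMeasurable fun p : Euc n × Euc n => ‖p.2 - f p.1‖ ^ 2 :=
    Measurable.stronglyMeasurable (((measurable_snd.sub (hf.comp measurable_fst)).norm).pow_const 2)
  rw [← integral_posterior_outLaw (f := fun p => ‖p.2 - f p.1‖ ^ 2) hm hi]
  refine integral_mono (integrable_postVar hc) (integrable_integral_posterior hm hi) fun y => ?_
  have := integral_norm_sub_sq (memLp_posterior ν hc 2 y) (f y)
  simp only at this ⊢
  rw [this, postVar, postMean]
  linarith [sq_nonneg ‖(∫ x, x ∂(posterior ν c y)) - f y‖]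

/-- The linear estimation bound. -/
lemma errVar_le_of_power (hc : c ≠ 0) (h2 : MemLp (fun x => x) 2 ν)
    (hp : ∫ x, ‖x‖ ^ 2 ∂ν ≤ n) : errVar ν c ≤ n / (1 + c ^ 2) := by
  -- This coefficient minimises (1 - lc)^2 + l^2, the error per coordinate at full power; the
  -- minimum is 1/(1 + c^2).
  set l : ℝ := c / (1 + c ^ 2) with hl
  have hd : 0 < 1 + c ^ 2 := by positivity
  have e : ∀ p : Euc n × Euc n, ‖p.1 - l • (c • p.1 + p.2)‖ ^ 2
      = (1 - l * c) ^ 2 * ‖p.1‖ ^ 2 + (l ^ 2 * ‖p.2‖ ^ 2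
        + (-2 * (1 - l * c) * l) * inner ℝ p.1 p.2) := by
    intro p
    rw [show p.1 - l • (c • p.1 + p.2) = (1 - l * c) • p.1 - l • p.2 by module,
      norm_sub_sq_real, norm_smul, norm_smul, mul_pow, mul_pow, inner_smul_left, inner_smul_right,
      Real.norm_eq_abs, Real.norm_eq_abs, sq_abs, sq_abs]
    simp
    ring
  have i1 : Integrable (fun p : Euc n × Euc n => ‖p.1‖ ^ 2) (ν.prod (stdG n)) :=
    (h2.integrable_norm_pow two_ne_zero).comp_fst _
  have i2 : Integrable (fun p : Euc n × Euc n => ‖p.2‖ ^ 2) (ν.prod (stdG n)) :=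
    (integrable_norm_pow_stdG 2).comp_snd _
  have i3 : Integrable (fun p : Euc n × Euc n => (inner ℝ p.1 p.2 : ℝ)) (ν.prod (stdG n)) := by
    refine (i1.add i2).mono' (by fun_prop) (Filter.Eventually.of_forall fun p => ?_)
    simp only [Pi.add_apply]
    have := norm_inner_le_norm (𝕜 := ℝ) p.1 p.2
    nlinarith [sq_nonneg (‖p.1‖ - ‖p.2‖), sq_nonneg ‖p.1‖, sq_nonneg ‖p.2‖]
  have z3 : ∫ p : Euc n × Euc n, (inner ℝ p.1 p.2 : ℝ) ∂(ν.prod (stdG n)) = 0 := by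
    rw [integral_prod _ i3]
    simp only
    have : ∀ x : Euc n, ∫ y, (inner ℝ x y : ℝ) ∂(stdG n) = 0 := fun x => by
      rw [integral_inner ((memLp_stdG 1 (by simp)).integrable le_rfl), integral_id_stdGaussian,
        inner_zero_right]
    simp [this]
  have hi : Integrable (fun p : Euc n × Euc n => ‖p.1 - l • (c • p.1 + p.2)‖ ^ 2)
      (ν.prod (stdG n)) := by
    simp_rw [e]
    exact (i1.const_mul _).add ((i2.const_mul _).add (i3.const_mul _))
  refine (errVar_le hc (f := fun y => l • y) (by fun_prop) hi).trans ?_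
  simp_rw [e]
  rw [integral_add (i1.const_mul _) ((i2.const_mul _).fun_add (i3.const_mul _)),
    integral_add (i2.const_mul _) (i3.const_mul _), integral_const_mul, integral_const_mul,
    integral_const_mul, z3, integral_fun_fst (fun x : Euc n => ‖x‖ ^ 2),
    integral_fun_snd (fun x : Euc n => ‖x‖ ^ 2), integral_norm_sq_stdG]
  simp only [probReal_univ, one_smul, mul_zero, add_zero]
  have h1 : (1 - l * c) ^ 2 * ∫ x, ‖x‖ ^ 2 ∂ν ≤ (1 - l * c) ^ 2 * n := by gcongr
  have h3 : (1 - l * c) ^ 2 * (n : ℝ) + l ^ 2 * n = n / (1 + c ^ 2) := by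
    rw [hl]; field_simp; ring
  linarith

end ErrorVariance

section Tilting

/-! ### Exponential tilting of a bounded random vector -/

section ChangeOfMeasure

variable {α : Type*} {mα : MeasurableSpace α} {π : Measure α} [IsProbabilityMeasure π]

/-- The covariance operator of the random vector `x`, applied to `h`. -/
def covVec (π : Measure α) (x : α → Euc n) (h : Euc n) : Euc n :=
  ∫ ω, (inner ℝ h (x ω - ∫ ω, x ω ∂π) : ℝ) • (x ω - ∫ ω, x ω ∂π) ∂π

lemma norm_integral_le_of_bound {x : α → Euc n} {R : ℝ} (hR : ∀ᵐ ω ∂π, ‖x ω‖ ≤ R) :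
    ‖∫ ω, x ω ∂π‖ ≤ R := by
  simpa using norm_integral_le_of_norm_le_const hR

lemma ae_norm_sub_integral_le {x : α → Euc n} {R : ℝ} (hR : ∀ᵐ ω ∂π, ‖x ω‖ ≤ R) :
    ∀ᵐ ω ∂π, ‖x ω - ∫ ω, x ω ∂π‖ ≤ 2 * R := by
  filter_upwards [hR] with ω h
  have := norm_sub_le (x ω) (∫ ω, x ω ∂π)
  have := norm_integral_le_of_bound hR
  linarith

lemma norm_covVec_le {x : α → Euc n} {R : ℝ} (hR : ∀ᵐ ω ∂π, ‖x ω‖ ≤ R) (h : Euc n) :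
    ‖covVec π x h‖ ≤ 4 * R ^ 2 * ‖h‖ := by
  refine norm_integral_le_of_bound ?_
  filter_upwards [ae_norm_sub_integral_le hR] with ω hω
  rw [norm_smul]
  have h1 := norm_inner_le_norm (𝕜 := ℝ) h (x ω - ∫ ω, x ω ∂π)
  calc _ ≤ (‖h‖ * ‖x ω - ∫ ω, x ω ∂π‖) * ‖x ω - ∫ ω, x ω ∂π‖ := by gcongr
    _ ≤ (‖h‖ * (2 * R)) * (2 * R) := by
        have := (norm_nonneg _).trans hω
        gcongr
    _ = _ := by ring

/-- First order expansion of the mean under an exponential change of measure. -/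
lemma norm_tilted_mean_sub_le {x : α → Euc n} (hx : AEStronglyMeasurable x π) {R : ℝ}
    (hR : ∀ᵐ ω ∂π, ‖x ω‖ ≤ R) (h : Euc n) :
    ‖(∫ ω, Real.exp (inner ℝ h (x ω)) ∂π)⁻¹ • ∫ ω, Real.exp (inner ℝ h (x ω)) • x ω ∂π
      - ∫ ω, x ω ∂π - covVec π x h‖ ≤ 16 * R ^ 3 * ‖h‖ ^ 2 := by
  set m := ∫ ω, x ω ∂π with hm
  have hR0 : 0 ≤ R := (norm_nonneg _).trans (norm_integral_le_of_bound hR)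
  have hb := ae_norm_sub_integral_le hR
  rw [← hm] at hb
  have hxi : Integrable x π := Integrable.of_bound hx R hR
  set u : α → ℝ := fun ω => inner ℝ h (x ω - m) with hu
  have hui : Integrable u π := (hxi.sub (integrable_const m)).const_inner h
  have hub : ∀ᵐ ω ∂π, |u ω| ≤ 2 * R * ‖h‖ := by
    filter_upwards [hb] with ω hω
    have := norm_inner_le_norm (𝕜 := ℝ) h (x ω - m)
    rw [Real.norm_eq_abs] at this
    nlinarith [norm_nonneg h]
  have hexpi : Integrable (fun ω => Real.exp (u ω)) π := by
    refine Integrable.of_bound (C := Real.exp (2 * R * ‖h‖)) ?_ ?_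
    · exact Real.continuous_exp.comp_aestronglyMeasurable hui.1
    · filter_upwards [hub] with ω hω
      rw [Real.norm_of_nonneg (Real.exp_nonneg _)]
      exact Real.exp_le_exp.2 ((le_abs_self _).trans hω)
  have hxm : Integrable (fun ω => x ω - m) π := hxi.sub (integrable_const m)
  have hsmul : ∀ v : α → ℝ, Integrable v π → Integrable (fun ω => v ω • (x ω - m)) π := by
    intro v hv
    refine (hv.norm.mul_const (2 * R)).mono' (hv.1.smul hxm.1) ?_
    filter_upwards [hb] with ω hω
    rw [norm_smul]
    gcongr
  have hexm : Integrable (fun ω => Real.exp (u ω) • (x ω - m)) π := hsmul _ hexpi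
  set E : ℝ := ∫ ω, Real.exp (u ω) ∂π with hE
  have hu0 : ∫ ω, u ω ∂π = 0 := by
    simp only [hu]
    rw [integral_inner hxm, integral_sub hxi (integrable_const m)]
    simp [← hm]
  -- Jensen: u is centred. The normalisation can therefore only shrink vectors.
  have hE1 : 1 ≤ E := by
    have : ∫ ω, (u ω + 1) ∂π ≤ E := integral_mono (hui.fun_add (integrable_const 1)) hexpi
      fun ω => Real.add_one_le_exp _
    rw [integral_add hui (integrable_const _), hu0] at this
    simpa using this
  -- Centring x at m multiplies all weights by the same factor exp⟨h, m⟩, which the normalisation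
  -- cancels.
  have hkey : (∫ ω, Real.exp (inner ℝ h (x ω)) ∂π)⁻¹ •
      ∫ ω, Real.exp (inner ℝ h (x ω)) • x ω ∂π - m
      = E⁻¹ • ∫ ω, Real.exp (u ω) • (x ω - m) ∂π := by
    have e1 : ∀ ω, Real.exp (inner ℝ h (x ω)) = Real.exp (inner ℝ h m) * Real.exp (u ω) := by
      intro ω
      rw [← Real.exp_add, hu]
      simp only [inner_sub_right]
      congr 1; ring
    have e2 : ∀ ω, Real.exp (u ω) • x ω = Real.exp (u ω) • (x ω - m) + Real.exp (u ω) • m := by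
      intro ω; rw [← smul_add, sub_add_cancel]
    simp_rw [e1, mul_smul]
    rw [integral_const_mul, integral_smul]
    simp_rw [e2]
    rw [integral_add hexm (hexpi.smul_const m), integral_smul_const, ← hE, smul_smul, mul_inv,
      mul_right_comm, inv_mul_cancel₀ (Real.exp_pos _).ne', one_mul, smul_add, smul_smul,
      inv_mul_cancel₀ (by positivity), one_smul, add_sub_cancel_right]
  rw [hkey]
  have hcov := norm_covVec_le hR h
  set V := covVec π x h with hV
  set N := ∫ ω, Real.exp (u ω) • (x ω - m) ∂π with hN
  -- If 2R‖h‖ ≤ 1, the exponential is expanded to first order; the errors in N and in E each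
  -- contribute at most 8R^3‖h‖^2. Otherwise both the tilted mean and V are crudely bounded, and
  -- each crude bound is already at most 8R^3‖h‖^2.
  rcases le_or_gt (2 * R * ‖h‖) 1 with hs | hs
  · have hr : ∀ᵐ ω ∂π, |Real.exp (u ω) - 1 - u ω| ≤ 4 * R ^ 2 * ‖h‖ ^ 2 := by
      filter_upwards [hub] with ω hω
      refine (Real.abs_exp_sub_one_sub_id_le (hω.trans hs)).trans ?_
      rw [← sq_abs]
      calc |u ω| ^ 2 ≤ (2 * R * ‖h‖) ^ 2 := by gcongr
        _ = _ := by ring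
    have hE2 : E - 1 ≤ 4 * R ^ 2 * ‖h‖ ^ 2 := by
      have : E - 1 = ∫ ω, (Real.exp (u ω) - 1 - u ω) ∂π := by
        rw [integral_sub (by exact hexpi.sub (integrable_const 1)) hui,
          integral_sub hexpi (integrable_const 1), hu0]
        simp [hE]
      rw [this]
      refine (le_abs_self _).trans ?_
      have := norm_integral_le_of_norm_le_const (μ := π)
        (f := fun ω => Real.exp (u ω) - 1 - u ω) hr
      simpa using this
    have hNV : ‖N - V‖ ≤ 8 * R ^ 3 * ‖h‖ ^ 2 := by
      have : N - V = ∫ ω, (Real.exp (u ω) - 1 - u ω) • (x ω - m) ∂π := by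
        have e : ∀ ω, (Real.exp (u ω) - 1 - u ω) • (x ω - m)
            = Real.exp (u ω) • (x ω - m) - (x ω - m) - u ω • (x ω - m) := by
          intro ω; module
        simp_rw [e]
        rw [integral_sub (by exact hexm.sub hxm) (hsmul u hui),
          integral_sub hexm hxm, integral_sub hxi (integrable_const m)]
        simp [← hm, hN, hV, covVec, hu]
      rw [this]
      refine norm_integral_le_of_bound ?_
      filter_upwards [hr, hb] with ω h1 h2
      rw [norm_smul, Real.norm_eq_abs]
      calc _ ≤ (4 * R ^ 2 * ‖h‖ ^ 2) * (2 * R) := by gcongr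
        _ = _ := by ring
    have hE0 : 0 < E := by linarith
    have hdec : E⁻¹ • N - V = E⁻¹ • (N - V) - (1 - E⁻¹) • V := by module
    have hinv : E⁻¹ ≤ 1 := inv_le_one_of_one_le₀ hE1
    have hinv0 : 0 ≤ E⁻¹ := by positivity
    have h1 : 1 - E⁻¹ ≤ 4 * R ^ 2 * ‖h‖ ^ 2 := by
      have : 1 - E⁻¹ = E⁻¹ * (E - 1) := by field_simp
      rw [this]
      nlinarith
    rw [hdec]
    refine (norm_sub_le _ _).trans ?_
    rw [norm_smul, norm_smul, Real.norm_of_nonneg hinv0, Real.norm_of_nonneg (by linarith)]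
    have h2 : E⁻¹ * ‖N - V‖ ≤ 8 * R ^ 3 * ‖h‖ ^ 2 := by nlinarith [norm_nonneg (N - V)]
    have h3 : (1 - E⁻¹) * ‖V‖ ≤ 8 * R ^ 3 * ‖h‖ ^ 2 := by
      calc (1 - E⁻¹) * ‖V‖ ≤ (4 * R ^ 2 * ‖h‖ ^ 2) * (4 * R ^ 2 * ‖h‖) := by
            gcongr
        _ = (8 * R ^ 3 * ‖h‖ ^ 2) * (2 * R * ‖h‖) := by ring
        _ ≤ (8 * R ^ 3 * ‖h‖ ^ 2) * 1 := by gcongr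
        _ = _ := by ring
    linarith
  · have hM : ‖E⁻¹ • N‖ ≤ 2 * R := by
      rw [norm_smul, Real.norm_of_nonneg (by positivity), inv_mul_eq_div, div_le_iff₀ (by positivity),
        hN, hE, ← integral_const_mul]
      refine norm_integral_le_of_norm_le (hexpi.const_mul _) ?_
      filter_upwards [hb] with ω hω
      rw [norm_smul, Real.norm_of_nonneg (Real.exp_nonneg _), mul_comm]
      gcongr
    refine (norm_sub_le _ _).trans ?_
    have h1 : 2 * R ≤ 8 * R ^ 3 * ‖h‖ ^ 2 := by
      calc 2 * R = 2 * R * 1 ^ 2 := by ring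
        _ ≤ 2 * R * (2 * R * ‖h‖) ^ 2 := by gcongr
        _ = _ := by ring
    have h2 : 4 * R ^ 2 * ‖h‖ ≤ 8 * R ^ 3 * ‖h‖ ^ 2 := by
      calc 4 * R ^ 2 * ‖h‖ = 4 * R ^ 2 * ‖h‖ * 1 := by ring
        _ ≤ 4 * R ^ 2 * ‖h‖ * (2 * R * ‖h‖) := by gcongr
        _ = _ := by ring
    linarith

end ChangeOfMeasure

/-! ### The error variance at nearby noise levels -/

variable {ν : Measure (Euc n)} [IsProbabilityMeasure ν] {c R : ℝ}

lemma tilt_add (c : ℝ) (x y h : Euc n) :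
    tilt c x (y + h) = tilt c x y * Real.exp (inner ℝ (c • h) x) := by
  rw [tilt, tilt, ← Real.exp_add, inner_add_right, inner_smul_left, real_inner_comm x h]
  simp only [conj_trivial]
  congr 1
  ring

lemma ae_posterior_of_ae {p : Euc n → Prop} (h : ∀ᵐ x ∂ν, p x) (y : Euc n) :
    ∀ᵐ x ∂(posterior ν c y), p x := by
  rw [posterior_apply]
  exact (withDensity_absolutelyContinuous _ _).ae_le h

lemma norm_postMean_le (hR : ∀ᵐ x ∂ν, ‖x‖ ≤ R) (y : Euc n) : ‖postMean ν c y‖ ≤ R :=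
  norm_integral_le_of_bound (ae_posterior_of_ae hR y)

/-- Moving the output by h multiplies the likelihood by a factor exp⟨c h, x⟩ and one free of x, so
the posterior mean at y + h is a tilted mean at y. To first order it moves by c·Cov(X|Y = y) h. -/
lemma postMean_add (y h : Euc n) :
    postMean ν c (y + h)
      = (∫ x, Real.exp (inner ℝ (c • h) x) ∂(posterior ν c y))⁻¹ •
        ∫ x, Real.exp (inner ℝ (c • h) x) • x ∂(posterior ν c y) := by
  rw [integral_posterior, integral_posterior, postMean, integral_posterior]
  simp_rw [smul_smul, ← tilt_add, smul_eq_mul, ← tilt_add]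
  rw [← outDensity, mul_inv, inv_inv, mul_right_comm,
    mul_inv_cancel₀ (outDensity_pos ν c y).ne', one_mul]

lemma covVec_posterior_apply (hc : c ≠ 0) (y h : Euc n) (i : Fin n) :
    covVec (posterior ν c y) (fun x => x) h i = ∑ j, postCov ν c y i j * h j := by
  have h2 := memLp_posterior ν hc 2 y
  have hI := fun i j => integrable_mul_coord h2 (postMean ν c y) i j
  have e : ∀ x : Euc n, ((inner ℝ h (x - postMean ν c y) : ℝ) • (x - postMean ν c y)) i
      = ∑ j, (x i - postMean ν c y i) * (x j - postMean ν c y j) * h j := by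
    intro x
    simp only [PiLp.smul_apply, PiLp.sub_apply, PiLp.inner_apply, RCLike.inner_apply, conj_trivial,
      smul_eq_mul, Finset.sum_mul]
    refine Finset.sum_congr rfl fun j _ => by ring
  have hint : Integrable (fun x : Euc n => (inner ℝ h (x - postMean ν c y) : ℝ) •
      (x - postMean ν c y)) (posterior ν c y) := by
    have hs := h2.sub (memLp_const (postMean ν c y))
    refine ((hs.integrable_norm_pow two_ne_zero).const_mul ‖h‖).mono' (by fun_prop)
      (Filter.Eventually.of_forall fun x => ?_)
    rw [norm_smul, sq, ← mul_assoc]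
    exact mul_le_mul_of_nonneg_right (norm_inner_le_norm _ _) (norm_nonneg _)
  change (∫ x, (inner ℝ h (x - postMean ν c y) : ℝ) • (x - postMean ν c y) ∂(posterior ν c y)) i = _
  rw [integral_coord hint]
  simp_rw [e]
  rw [integral_finsetSum _ fun j _ => (hI i j).mul_const _]
  simp_rw [integral_mul_const]
  rfl

lemma norm_covVec_posterior_sq (hc : c ≠ 0) (y h : Euc n) :
    ‖covVec (posterior ν c y) (fun x => x) h‖ ^ 2 = ∑ i, (∑ j, postCov ν c y i j * h j) ^ 2 := by
  rw [EuclideanSpace.real_norm_sq_eq]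
  simp_rw [covVec_posterior_apply hc]

lemma norm_postMean_add_sub_sq_le (hR : ∀ᵐ x ∂ν, ‖x‖ ≤ R) (hc : 0 < c) (s : ℝ) (hs : 0 ≤ s)
    (y z : Euc n) :
    ‖postMean ν c y - postMean ν c (y + s • z)‖ ^ 2
      ≤ s ^ 2 * c ^ 2 * ∑ i, (∑ j, postCov ν c y i j * z j) ^ 2
        + (128 * R ^ 5 * c ^ 3 * s ^ 3 * ‖z‖ ^ 3 + 256 * R ^ 6 * c ^ 4 * s ^ 4 * ‖z‖ ^ 4) := by
  have hR0 : 0 ≤ R := (norm_nonneg _).trans (norm_postMean_le (c := c) hR y)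
  have h1 := norm_tilted_mean_sub_le (x := fun x : Euc n => x) (by fun_prop)
    (ae_posterior_of_ae (c := c) hR y) (c • s • z)
  have h2 := norm_covVec_le (ae_posterior_of_ae (c := c) hR y) (c • s • z)
  have h3 := norm_covVec_posterior_sq (ν := ν) hc.ne' y (c • s • z)
  rw [← postMean_add] at h1
  change ‖postMean ν c (y + s • z) - postMean ν c y - _‖ ≤ _ at h1
  set V := covVec (posterior ν c y) (fun x => x) (c • s • z)
  have hn : ‖c • s • z‖ = c * s * ‖z‖ := by
    rw [norm_smul, norm_smul, Real.norm_of_nonneg hc.le, Real.norm_of_nonneg hs]; ring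
  rw [hn] at h1 h2
  have h4 : ‖V‖ ^ 2 = s ^ 2 * c ^ 2 * ∑ i, (∑ j, postCov ν c y i j * z j) ^ 2 := by
    rw [h3, Finset.mul_sum]
    refine Finset.sum_congr rfl fun i _ => ?_
    rw [← mul_pow, ← mul_pow, Finset.mul_sum]
    congr 1
    refine Finset.sum_congr rfl fun j _ => ?_
    simp; ring
  rw [norm_sub_rev, ← h4]
  set D := postMean ν c (y + s • z) - postMean ν c y
  have h5 : ‖D‖ ≤ ‖D - V‖ + ‖V‖ := by simpa using norm_add_le (D - V) V
  have hz := norm_nonneg z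
  calc ‖D‖ ^ 2 ≤ (‖D - V‖ + ‖V‖) ^ 2 := by gcongr
    _ = ‖V‖ ^ 2 + (2 * ‖D - V‖ * ‖V‖ + ‖D - V‖ ^ 2) := by ring
    -- The first order remainder 16R^3 and the operator bound 4R^2 yield 2·16·4 = 128 in the cross
    -- term and 16^2 = 256 in the squared remainder.
    _ ≤ ‖V‖ ^ 2 + (2 * (16 * R ^ 3 * (c * s * ‖z‖) ^ 2) * (4 * R ^ 2 * (c * s * ‖z‖))
          + (16 * R ^ 3 * (c * s * ‖z‖) ^ 2) ^ 2) := by gcongr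
    _ = _ := by ring

lemma integrable_mul_mul_coord_stdG (a b : ℝ) (i j : Fin n) :
    Integrable (fun z : Euc n => (a * z i) * (b * z j)) (stdG n) := by
  refine ((integrable_mul_coord_stdG i j).const_mul (a * b)).congr
    (Filter.Eventually.of_forall fun z => ?_)
  simp only; ring

lemma integrable_sum_sq_stdG (C : Fin n → Fin n → ℝ) :
    Integrable (fun z : Euc n => ∑ i, (∑ j, C i j * z j) ^ 2) (stdG n) := by
  simp_rw [sq, Finset.sum_mul_sum]
  exact integrable_finsetSum _ fun i _ => integrable_finsetSum _ fun j _ =>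
    integrable_finsetSum _ fun k _ => integrable_mul_mul_coord_stdG _ _ _ _

/-- E‖Cz‖^2 = ‖C‖_F^2 because z has identity covariance; averaging over the added noise thus
produces the Frobenius norm. -/
lemma integral_sum_sq_stdG (C : Fin n → Fin n → ℝ) :
    ∫ z, ∑ i, (∑ j, C i j * z j) ^ 2 ∂(stdG n) = ∑ i, ∑ j, C i j ^ 2 := by
  simp_rw [sq, Finset.sum_mul_sum]
  rw [integral_finsetSum _ fun i _ => integrable_finsetSum _ fun j _ =>
    integrable_finsetSum _ fun k _ => integrable_mul_mul_coord_stdG _ _ _ _]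
  refine Finset.sum_congr rfl fun i _ => ?_
  rw [integral_finsetSum _ fun j _ =>
    integrable_finsetSum _ fun k _ => integrable_mul_mul_coord_stdG _ _ _ _]
  refine Finset.sum_congr rfl fun j _ => ?_
  rw [integral_finsetSum _ fun k _ => integrable_mul_mul_coord_stdG _ _ _ _]
  have : ∀ k, ∫ z : Euc n, (C i j * z j) * (C i k * z k) ∂(stdG n)
      = C i j * C i k * if j = k then 1 else 0 := by
    intro k
    rw [← integral_mul_coord_stdG, ← integral_const_mul]
    congr 1 with z
    ring
  simp [this]

/-- Splitting the noise into two independent parts. -/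
lemma map_prod_smul_eq (s : ℝ) :
    (ν.prod (stdG n)).map (fun p => (p.1, Real.sqrt (1 + s ^ 2) • p.2))
      = ((stdG n).prod (ν.prod (stdG n))).map (fun q => (q.2.1, q.2.2 + s • q.1)) := by
  refine Measure.ext_of_lintegral _ fun f hf => ?_
  have hfx : ∀ x, Measurable fun z => f (x, z) := fun x => hf.comp measurable_prodMk_left
  have hm2 : Measurable fun q : Euc n × Euc n × Euc n => f (q.2.1, q.2.2 + s • q.1) :=
    hf.comp (by fun_prop : Measurable fun q : Euc n × Euc n × Euc n => (q.2.1, q.2.2 + s • q.1))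
  have hm1 : Measurable fun p : Euc n × Euc n => f (p.1, Real.sqrt (1 + s ^ 2) • p.2) :=
    hf.comp (by fun_prop : Measurable fun p : Euc n × Euc n => (p.1, Real.sqrt (1 + s ^ 2) • p.2))
  rw [lintegral_map hf (by fun_prop), lintegral_map hf (by fun_prop),
    lintegral_prod _ hm1.aemeasurable, lintegral_prod _ hm2.aemeasurable]
  have hm3 : ∀ z : Euc n, Measurable fun p : Euc n × Euc n => f (p.1, p.2 + s • z) := fun z =>
    hf.comp (by fun_prop : Measurable fun p : Euc n × Euc n => (p.1, p.2 + s • z))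
  have e : ∀ z, ∫⁻ p : Euc n × Euc n, f (p.1, p.2 + s • z) ∂(ν.prod (stdG n))
      = ∫⁻ x, ∫⁻ w, f (x, w + s • z) ∂(stdG n) ∂ν := fun z => by
    rw [lintegral_prod _ (hm3 z).aemeasurable]
  simp_rw [e]
  symm
  rw [lintegral_lintegral_swap]
  · refine lintegral_congr fun x => ?_
    have h1 := lintegral_map (μ := stdG n) (hfx x)
      (by fun_prop : Measurable fun z : Euc n => Real.sqrt (1 + s ^ 2) • z)
    have hg : Measurable fun p : Euc n × Euc n => p.1 + s • p.2 := by fun_prop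
    rw [← h1, ← map_add_smul_stdG, lintegral_map (hfx x) hg]
    exact (lintegral_prod_symm _ ((hfx x).comp hg).aemeasurable).symm
  · have hm4 : Measurable fun q : (Euc n × Euc n) × Euc n => f (q.1.2, q.2 + s • q.1.1) :=
      hf.comp (by fun_prop :
        Measurable fun q : (Euc n × Euc n) × Euc n => (q.1.2, q.2 + s • q.1.1))
    exact hm4.lintegral_prod_right'.aemeasurable

lemma norm_sub_postMean_sq_le (hR : ∀ᵐ x ∂ν, ‖x‖ ≤ R) {x : Euc n} (hx : ‖x‖ ≤ R) (y : Euc n) :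
    ‖‖x - postMean ν c y‖ ^ 2‖ ≤ (2 * R) ^ 2 := by
  rw [norm_pow, norm_norm]
  have := norm_sub_le x (postMean ν c y)
  have := norm_postMean_le (c := c) hR y
  gcongr
  linarith

lemma integrable_norm_postMean_sub_sq (hR : ∀ᵐ x ∂ν, ‖x‖ ≤ R) (s : ℝ) :
    Integrable (fun p : Euc n × Euc n =>
      ‖postMean ν c p.1 - postMean ν c (p.1 + s • p.2)‖ ^ 2) ((outLaw ν c).prod (stdG n)) := by
  have hmM := measurable_postMean ν c
  have hDm : Measurable fun p : Euc n × Euc n =>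
      ‖postMean ν c p.1 - postMean ν c (p.1 + s • p.2)‖ ^ 2 :=
    (((hmM.comp measurable_fst).sub (hmM.comp (by fun_prop))).norm).pow_const 2
  exact Integrable.of_bound hDm.aestronglyMeasurable _
    (Filter.Eventually.of_forall fun p => norm_sub_postMean_sq_le hR (norm_postMean_le hR p.1) _)

/-- The estimator that is optimal for the output with less noise is used for the output with more
noise. -/
lemma errVar_le_add_integral (hR : ∀ᵐ x ∂ν, ‖x‖ ≤ R) (hc : 0 < c) {s : ℝ}
    {c₁ : ℝ}
    (hc₁ : 0 < c₁) (hcc : c = Real.sqrt (1 + s ^ 2) * c₁) :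
    errVar ν c₁ ≤ errVar ν c
      + ∫ z, ∫ y, ‖postMean ν c y - postMean ν c (y + s • z)‖ ^ 2 ∂(outLaw ν c) ∂(stdG n) := by
  set κ := Real.sqrt (1 + s ^ 2) with hκ
  have hmM := measurable_postMean ν c
  have hae : ∀ᵐ p ∂(ν.prod (stdG n)), ‖p.1‖ ≤ R := Measure.quasiMeasurePreserving_fst.ae hR
  have hae3 : ∀ᵐ q ∂((stdG n).prod (ν.prod (stdG n))), ‖q.2.1‖ ≤ R :=
    Measure.quasiMeasurePreserving_snd.ae hae
  have hF : Measurable fun p : Euc n × Euc n => ‖p.1 - postMean ν c (c • p.1 + p.2)‖ ^ 2 :=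
    ((measurable_fst.sub (hmM.comp (by fun_prop))).norm).pow_const 2
  -- The estimator rescales the noisier output by κ: κ(c₁X + Z) = cX + κZ, and κZ has the law of Z +
  -- sZ', so it is the less noisy output plus s times fresh noise.
  have hf : Measurable fun y => postMean ν c (κ • y) := hmM.comp (by fun_prop)
  have hlin : ∀ p : Euc n × Euc n, κ • (c₁ • p.1 + p.2) = c • p.1 + κ • p.2 := by
    intro p; rw [smul_add, smul_smul, ← hcc]
  have hi : Integrable (fun p : Euc n × Euc n => ‖p.1 - postMean ν c (κ • (c₁ • p.1 + p.2))‖ ^ 2)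
      (ν.prod (stdG n)) := by
    refine Integrable.of_bound (C := (2 * R) ^ 2) ?_ ?_
    · exact (((measurable_fst.sub (hmM.comp (by fun_prop))).norm).pow_const 2).aestronglyMeasurable
    · filter_upwards [hae] with p hp using norm_sub_postMean_sq_le hR hp _
  have h1 := errVar_le hc₁.ne' hf hi
  simp_rw [hlin] at h1
  have hmap := integral_map (μ := ν.prod (stdG n))
    (φ := fun p => (p.1, κ • p.2)) (by fun_prop) (hF.aestronglyMeasurable)
  simp only at hmap
  rw [← hmap, map_prod_smul_eq, integral_map (by fun_prop) hF.aestronglyMeasurable] at h1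
  have hi3 : Integrable (fun q : Euc n × Euc n × Euc n =>
      ‖q.2.1 - postMean ν c (c • q.2.1 + (q.2.2 + s • q.1))‖ ^ 2)
      ((stdG n).prod (ν.prod (stdG n))) := by
    refine Integrable.of_bound (C := (2 * R) ^ 2) ?_ ?_
    · exact (((measurable_snd.fst.sub
        (hmM.comp (by fun_prop))).norm).pow_const 2).aestronglyMeasurable
    · filter_upwards [hae3] with p hp using norm_sub_postMean_sq_le hR hp _
  rw [integral_prod _ hi3] at h1
  -- With the extra noise z frozen, the bias-variance decomposition under the posterior separates
  -- the optimal error from the displacement of the posterior mean.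
  have hinner : ∀ z, ∫ p : Euc n × Euc n,
      ‖p.1 - postMean ν c (c • p.1 + (p.2 + s • z))‖ ^ 2 ∂(ν.prod (stdG n))
      = errVar ν c + ∫ y, ‖postMean ν c y - postMean ν c (y + s • z)‖ ^ 2 ∂(outLaw ν c) := by
    intro z
    have hm : StronglyMeasurable fun p : Euc n × Euc n =>
        ‖p.2 - postMean ν c (p.1 + s • z)‖ ^ 2 :=
      (((measurable_snd.sub (hmM.comp (by fun_prop))).norm).pow_const 2).stronglyMeasurable
    have hi4 : Integrable (fun p : Euc n × Euc n =>
        ‖p.1 - postMean ν c (c • p.1 + p.2 + s • z)‖ ^ 2) (ν.prod (stdG n)) := by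
      refine Integrable.of_bound (C := (2 * R) ^ 2) ?_ ?_
      · exact (((measurable_fst.sub
          (hmM.comp (by fun_prop))).norm).pow_const 2).aestronglyMeasurable
      · filter_upwards [hae] with p hp using norm_sub_postMean_sq_le hR hp _
    have := integral_posterior_outLaw (ν := ν) (c := c) (f := fun p : Euc n × Euc n =>
        ‖p.2 - postMean ν c (p.1 + s • z)‖ ^ 2) hm hi4
    simp only at this
    simp_rw [← add_assoc]
    rw [← this, errVar, ← integral_add (integrable_postVar hc.ne')]
    · congr 1 with y
      exact integral_norm_sub_sq (memLp_posterior ν hc.ne' 2 y) _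
    · refine Integrable.of_bound (C := (2 * R) ^ 2) ?_ (Filter.Eventually.of_forall fun y => ?_)
      · exact (((hmM.sub (hmM.comp (by fun_prop))).norm).pow_const 2).aestronglyMeasurable
      · exact norm_sub_postMean_sq_le hR (norm_postMean_le hR y) _
  simp only at h1
  simp_rw [hinner] at h1
  have hDi := integrable_norm_postMean_sub_sq (c := c) hR s
  refine h1.trans_eq ?_
  rw [integral_add (integrable_const _) hDi.integral_prod_right]
  simp

/-- The growth of the error variance of a bounded input when the noise variance increases from
`1 / c ^ 2` to `(1 + s ^ 2) / c ^ 2`. -/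
lemma errVar_step (hR : ∀ᵐ x ∂ν, ‖x‖ ≤ R) (hc : 0 < c) {s : ℝ} (hs : 0 ≤ s) {c₁ : ℝ}
    (hc₁ : 0 < c₁) (hcc : c = Real.sqrt (1 + s ^ 2) * c₁) :
    errVar ν c₁ ≤ errVar ν c
      + s ^ 2 * c ^ 2 * ∫ y, ∑ i, ∑ j, postCov ν c y i j ^ 2 ∂(outLaw ν c)
      + (128 * R ^ 5 * c ^ 3 * s ^ 3 * ∫ z, ‖z‖ ^ 3 ∂(stdG n)
        + 256 * R ^ 6 * c ^ 4 * s ^ 4 * ∫ z, ‖z‖ ^ 4 ∂(stdG n)) := by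
  refine (errVar_le_add_integral hR hc hc₁ hcc).trans ?_
  have hmM := measurable_postMean ν c
  have hQm : Measurable fun p : Euc n × Euc n => ∑ i, (∑ j, postCov ν c p.1 i j * p.2 j) ^ 2 := by
    refine Finset.measurable_sum _ fun i _ => Measurable.pow_const
      (Finset.measurable_sum _ fun j _ => Measurable.mul ?_ (by fun_prop)) 2
    exact (stronglyMeasurable_postCov ν c i j).measurable.comp measurable_fst
  have hQ0 : ∀ y z : Euc n, 0 ≤ ∑ i, (∑ j, postCov ν c y i j * z j) ^ 2 := fun y z =>
    Finset.sum_nonneg fun i _ => sq_nonneg _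
  have hQi : Integrable (fun p : Euc n × Euc n => ∑ i, (∑ j, postCov ν c p.1 i j * p.2 j) ^ 2)
      ((outLaw ν c).prod (stdG n)) := by
    rw [integrable_prod_iff hQm.aestronglyMeasurable]
    refine ⟨Filter.Eventually.of_forall fun y => integrable_sum_sq_stdG (postCov ν c y), ?_⟩
    have : ∀ y, ∫ z : Euc n, ‖∑ i, (∑ j, postCov ν c y i j * z j) ^ 2‖ ∂(stdG n)
        = ∑ i, ∑ j, postCov ν c y i j ^ 2 := fun y => by
      simp_rw [Real.norm_of_nonneg (hQ0 y _)]
      exact integral_sum_sq_stdG (postCov ν c y)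
    simp_rw [this]
    exact integrable_sum_sq_postCov hc.ne'
  have hDi := integrable_norm_postMean_sub_sq (c := c) hR s
  have hEi3 : Integrable (fun p : Euc n × Euc n => 128 * R ^ 5 * c ^ 3 * s ^ 3 * ‖p.2‖ ^ 3)
      ((outLaw ν c).prod (stdG n)) := by
    have h : Integrable (fun p : Euc n × Euc n => ‖p.2‖ ^ 3) ((outLaw ν c).prod (stdG n)) :=
      Integrable.comp_snd (f := fun z : Euc n => ‖z‖ ^ 3) (integrable_norm_pow_stdG 3) _
    exact h.const_mul _
  have hEi4 : Integrable (fun p : Euc n × Euc n => 256 * R ^ 6 * c ^ 4 * s ^ 4 * ‖p.2‖ ^ 4)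
      ((outLaw ν c).prod (stdG n)) := by
    have h : Integrable (fun p : Euc n × Euc n => ‖p.2‖ ^ 4) ((outLaw ν c).prod (stdG n)) :=
      Integrable.comp_snd (f := fun z : Euc n => ‖z‖ ^ 4) (integrable_norm_pow_stdG 4) _
    exact h.const_mul _
  have hmono := integral_mono hDi ((hQi.const_mul (s ^ 2 * c ^ 2)).fun_add (hEi3.fun_add hEi4))
    (fun p => norm_postMean_add_sub_sq_le hR hc s hs p.1 p.2)
  rw [integral_prod_symm _ hDi, integral_add (hQi.const_mul _) (hEi3.fun_add hEi4),
    integral_add hEi3 hEi4, integral_const_mul, integral_const_mul, integral_const_mul,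
    integral_prod _ hQi, integral_fun_snd (fun x : Euc n => ‖x‖ ^ 3),
    integral_fun_snd (fun x : Euc n => ‖x‖ ^ 4)] at hmono
  simp only [probReal_univ, one_smul, integral_sum_sq_stdG] at hmono
  linarith

end Tilting

section Growth

open Filter

/-! ### From small steps to large steps -/

/-- A function whose increments are bounded by a superlinear function of the step does not
increase. -/
lemma le_of_increment_le {G : ℝ → ℝ} {a b K : ℝ} (hab : a ≤ b)
    (h : ∀ s t, a ≤ s → s ≤ t → t ≤ b →
      G t - G s ≤ K * ((t - s) * (Real.sqrt (t - s) + (t - s)))) : G b ≤ G a := by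
  -- With N + 1 equal steps of length d the errors add up to K(b - a)(√d + d), which tends to 0.
  have key : ∀ N : ℕ, G b - G a ≤ K * ((b - a) *
      (Real.sqrt ((b - a) * (1 / ((N : ℝ) + 1))) + (b - a) * (1 / ((N : ℝ) + 1)))) := by
    intro N
    have hN : (0 : ℝ) < (N : ℝ) + 1 := by positivity
    set d := (b - a) * (1 / ((N : ℝ) + 1)) with hd
    have hd0 : 0 ≤ d := mul_nonneg (by linarith) (by positivity)
    have hdN : ((N : ℝ) + 1) * d = b - a := by rw [hd]; field_simp
    have hind : ∀ k : ℕ, k ≤ N + 1 →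
        G (a + k * d) - G a ≤ k * (K * (d * (Real.sqrt d + d))) := by
      intro k
      induction k with
      | zero => simp
      | succ k ih =>
        intro hk
        have h1 := ih (by omega)
        have h2 := h (a + k * d) (a + ((k + 1 : ℕ) : ℝ) * d) (by nlinarith [(k.cast_nonneg : (0:ℝ) ≤ k)])
          (by push_cast; linarith) (by
            have : ((k + 1 : ℕ) : ℝ) ≤ (N : ℝ) + 1 := by exact_mod_cast hk
            nlinarith)
        rw [show a + ((k + 1 : ℕ) : ℝ) * d - (a + k * d) = d by push_cast; ring] at h2
        push_cast at h2 ⊢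
        linarith
    have h1 := hind (N + 1) le_rfl
    push_cast at h1
    rw [hdN, add_sub_cancel] at h1
    refine h1.trans_eq ?_
    rw [← hdN]
    ring
  have hlim : Tendsto (fun N : ℕ => K * ((b - a) *
      (Real.sqrt ((b - a) * (1 / ((N : ℝ) + 1))) + (b - a) * (1 / ((N : ℝ) + 1))))) atTop (𝓝 0) := by
    have h0 := (tendsto_one_div_add_atTop_nhds_zero_nat (𝕜 := ℝ)).const_mul (b - a)
    rw [mul_zero] at h0
    have h1 := (Real.continuous_sqrt.tendsto 0).comp h0
    rw [Real.sqrt_zero] at h1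
    simpa using ((h1.add h0).const_mul (b - a)).const_mul K
  linarith [ge_of_tendsto' hlim key]

variable {ν : Measure (Euc n)} [IsProbabilityMeasure ν] {R : ℝ}

/-- The mean squared Frobenius norm of the posterior covariance matrix of the noise, when the noise
variance is `t`. -/
def covEnergy (ν : Measure (Euc n)) [IsProbabilityMeasure ν] (t : ℝ) : ℝ :=
  (1 / Real.sqrt t) ^ 4 *
    ∫ y, ∑ i, ∑ j, postCov ν (1 / Real.sqrt t) y i j ^ 2 ∂(outLaw ν (1 / Real.sqrt t))

lemma covEnergy_le {t : ℝ} (ht : 0 < t) :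
    covEnergy ν t ≤ (n : ℝ) ^ 2 + 2 * n
      - (n - (1 / Real.sqrt t) ^ 2 * errVar ν (1 / Real.sqrt t)) ^ 2 :=
  integral_sum_sq_postCov_le (one_div_pos.2 (Real.sqrt_pos.2 ht)).ne'

lemma covEnergy_le_of_power {t : ℝ} (ht : 0 < t) (h2 : MemLp (fun x => x) 2 ν)
    (hp : ∫ x, ‖x‖ ^ 2 ∂ν ≤ n) :
    covEnergy ν t ≤ (n : ℝ) ^ 2 + 2 * n - n * (t / (1 + t)) ^ 2 := by
  have hc := (one_div_pos.2 (Real.sqrt_pos.2 ht))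
  have h := errVar_le_of_power hc.ne' h2 hp
  have h1 := covEnergy_le (ν := ν) ht
  have hc2 : (1 / Real.sqrt t) ^ 2 = 1 / t := by rw [div_pow, Real.sq_sqrt ht.le, one_pow]
  rw [hc2] at h h1
  set e := errVar ν (1 / Real.sqrt t)
  have h3 : (n : ℝ) * (t / (1 + t)) ≤ n - 1 / t * e := by
    have : 1 / t * e ≤ 1 / t * (n / (1 + 1 / t)) := by gcongr
    refine le_trans (le_of_eq ?_) (sub_le_sub_left this _)
    field_simp
    ring
  have h4 : ((n : ℝ) * (t / (1 + t))) ^ 2 ≤ (n - 1 / t * e) ^ 2 := by gcongr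
  -- Only n^2 ≥ n is used here. After division by n this leaves (t/(1+t))^2, the integrand behind Δ.
  have h5 : (n : ℝ) * (t / (1 + t)) ^ 2 ≤ ((n : ℝ) * (t / (1 + t))) ^ 2 := by
    rw [mul_pow]
    gcongr
    exact_mod_cast Nat.le_self_pow two_ne_zero n
  linarith

/-- One small step, with a bound on the error that is uniform in the noise variance. -/
lemma errVar_sub_le_step (hR : ∀ᵐ x ∂ν, ‖x‖ ≤ R) (hR0 : 0 ≤ R) {a t₀ t₁ : ℝ} (ha : 0 < a)
    (h0 : a ≤ t₀) (h1 : t₀ ≤ t₁) :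
    errVar ν (1 / Real.sqrt t₁) - errVar ν (1 / Real.sqrt t₀)
      ≤ (t₁ - t₀) * covEnergy ν t₀
        + (128 * R ^ 5 * (1 / Real.sqrt a) ^ 6 * ∫ z, ‖z‖ ^ 3 ∂(stdG n)
          + 256 * R ^ 6 * (1 / Real.sqrt a) ^ 8 * ∫ z, ‖z‖ ^ 4 ∂(stdG n))
          * ((t₁ - t₀) * (Real.sqrt (t₁ - t₀) + (t₁ - t₀))) := by
  have ht0 : 0 < t₀ := ha.trans_le h0
  have ht1 : 0 < t₁ := ht0.trans_le h1
  set d := t₁ - t₀ with hd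
  have hd0 : 0 ≤ d := sub_nonneg.2 h1
  set c := 1 / Real.sqrt t₀ with hc
  have hc0 : 0 < c := one_div_pos.2 (Real.sqrt_pos.2 ht0)
  have hc2 : c ^ 2 = 1 / t₀ := by rw [hc, div_pow, Real.sq_sqrt ht0.le, one_pow]
  -- Chosen so that 1 + s^2 = t₁/t₀. The main term s^2 c^2 becomes c^4 d, and the cubic error
  -- contains d√d, which is where the square root in the increment bound comes from.
  set s := c * Real.sqrt d with hs
  have hs0 : 0 ≤ s := by positivity
  have hs2 : s ^ 2 = c ^ 2 * d := by rw [hs, mul_pow, Real.sq_sqrt hd0]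
  have hcc : c = Real.sqrt (1 + s ^ 2) * (1 / Real.sqrt t₁) := by
    have : 1 + s ^ 2 = t₁ / t₀ := by rw [hs2, hc2, hd]; field_simp; ring
    rw [this, Real.sqrt_div ht1.le, hc]
    have := Real.sqrt_pos.2 ht1
    field_simp
  have hstep := errVar_step hR hc0 hs0 (one_div_pos.2 (Real.sqrt_pos.2 ht1)) hcc
  have hA : c ≤ 1 / Real.sqrt a := by
    rw [hc]
    exact one_div_le_one_div_of_le (Real.sqrt_pos.2 ha) (Real.sqrt_le_sqrt h0)
  set A := 1 / Real.sqrt a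
  have hA0 : 0 ≤ A := hc0.le.trans hA
  have hsd : Real.sqrt d ^ 2 = d := Real.sq_sqrt hd0
  have e3 : s ^ 3 = c ^ 3 * (d * Real.sqrt d) := by rw [hs]; linear_combination c ^ 3 * Real.sqrt d * hsd
  have e4 : s ^ 4 = c ^ 4 * (d * d) := by
    rw [show s ^ 4 = (s ^ 2) ^ 2 by ring, hs2]; ring
  have hM3 : 0 ≤ ∫ z, ‖z‖ ^ 3 ∂(stdG n) := integral_nonneg fun z => by positivity
  have hM4 : 0 ≤ ∫ z, ‖z‖ ^ 4 ∂(stdG n) := integral_nonneg fun z => by positivity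
  set M3 := ∫ z, ‖z‖ ^ 3 ∂(stdG n)
  set M4 := ∫ z, ‖z‖ ^ 4 ∂(stdG n)
  have b3 : 128 * R ^ 5 * c ^ 3 * s ^ 3 * M3 ≤ 128 * R ^ 5 * A ^ 6 * M3 * (d * (Real.sqrt d + d)) := by
    calc 128 * R ^ 5 * c ^ 3 * s ^ 3 * M3 = 128 * R ^ 5 * c ^ 6 * M3 * (d * (Real.sqrt d + 0)) := by
          rw [e3]; ring
      _ ≤ _ := by gcongr
  have b4 : 256 * R ^ 6 * c ^ 4 * s ^ 4 * M4 ≤ 256 * R ^ 6 * A ^ 8 * M4 * (d * (Real.sqrt d + d)) := by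
    calc 256 * R ^ 6 * c ^ 4 * s ^ 4 * M4 = 256 * R ^ 6 * c ^ 8 * M4 * (d * (0 + d)) := by
          rw [e4]; ring
      _ ≤ _ := by gcongr; positivity
  have hmain : s ^ 2 * c ^ 2 * ∫ y, ∑ i, ∑ j, postCov ν c y i j ^ 2 ∂(outLaw ν c)
      = d * covEnergy ν t₀ := by
    rw [hs2, covEnergy, ← hc]; ring
  rw [hmain] at hstep
  linarith

/-- The growth of the error variance of a bounded input. -/
lemma errVar_sub_le_of_bounded (hR : ∀ᵐ x ∂ν, ‖x‖ ≤ R) {a b : ℝ} (ha : 0 < a) (hab : a ≤ b)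
    {Ψ : ℝ → ℝ} {L : ℝ}
    (hΨ : ∀ s t, a ≤ s → s ≤ t → (t - s) * covEnergy ν s ≤ Ψ t - Ψ s + L * (t - s) ^ 2) :
    errVar ν (1 / Real.sqrt b) - errVar ν (1 / Real.sqrt a) ≤ Ψ b - Ψ a := by
  have hR0 : 0 ≤ R := (norm_nonneg _).trans (norm_postMean_le (c := 1) hR 0)
  set C := 128 * R ^ 5 * (1 / Real.sqrt a) ^ 6 * ∫ z, ‖z‖ ^ 3 ∂(stdG n)
          + 256 * R ^ 6 * (1 / Real.sqrt a) ^ 8 * ∫ z, ‖z‖ ^ 4 ∂(stdG n)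
  -- Ψ plays the role of a primitive of an upper bound for `covEnergy`; the quadratic slack L(t -
  -- s)^2 pays for evaluating the energy at the left endpoint and is absorbed into K.
  have := le_of_increment_le (G := fun t => errVar ν (1 / Real.sqrt t) - Ψ t) (K := C + |L|) hab
    (fun s t hs hst _ => by
      have h1 := errVar_sub_le_step hR hR0 ha hs hst
      have h2 := hΨ s t hs hst
      have hd : 0 ≤ t - s := sub_nonneg.2 hst
      have h3 : L * (t - s) ^ 2 ≤ |L| * ((t - s) * (Real.sqrt (t - s) + (t - s))) := by
        calc L * (t - s) ^ 2 ≤ |L| * ((t - s) * (0 + (t - s))) := by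
              rw [zero_add, ← sq]; gcongr; exact le_abs_self L
          _ ≤ _ := by gcongr; positivity
      rw [add_mul]
      linarith)
  linarith

/-- An antiderivative of `(t / (1 + t)) ^ 2`. -/
def gainFun (t : ℝ) : ℝ := t - 2 * Real.log (1 + t) - 1 / (1 + t)

lemma hasDerivAt_gainFun {t : ℝ} (ht : 0 < t) : HasDerivAt gainFun ((t / (1 + t)) ^ 2) t := by
  have h1 : HasDerivAt (fun t : ℝ => 1 + t) 1 t := (hasDerivAt_id t).const_add 1
  have hne : 1 + t ≠ 0 := by positivity
  have h := ((hasDerivAt_id t).sub ((h1.log hne).const_mul 2)).sub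
    ((hasDerivAt_const t (1 : ℝ)).div h1 hne)
  refine h.congr_deriv ?_
  field_simp
  ring

/-- Mean value theorem: t/(1+t) is 1-Lipschitz with values in [0, 1], so its square, the derivative
of `gainFun`, is 2-Lipschitz. -/
lemma gainFun_sub_le {s t : ℝ} (hs : 0 < s) (hst : s ≤ t) :
    gainFun t - gainFun s ≤ (t - s) * (s / (1 + s)) ^ 2 + 2 * (t - s) ^ 2 := by
  rcases hst.eq_or_lt with rfl | hlt
  · simp
  obtain ⟨ξ, ⟨h1, h2⟩, h3⟩ := exists_hasDerivAt_eq_slope gainFun (fun t => (t / (1 + t)) ^ 2) hlt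
    (fun x hx => (hasDerivAt_gainFun (hs.trans_le hx.1)).continuousAt.continuousWithinAt)
    (fun x hx => hasDerivAt_gainFun (hs.trans hx.1))
  have hd : 0 < t - s := sub_pos.2 hlt
  rw [eq_div_iff hd.ne'] at h3
  rw [← h3]
  have hξ : 0 < ξ := hs.trans h1
  have e : ξ / (1 + ξ) - s / (1 + s) = (ξ - s) / ((1 + ξ) * (1 + s)) := by field_simp; ring
  have h4 : ξ / (1 + ξ) - s / (1 + s) ≤ t - s := by
    rw [e]
    refine (div_le_self (by linarith) ?_).trans (by linarith)
    nlinarith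
  have h40 : 0 ≤ ξ / (1 + ξ) - s / (1 + s) := by
    rw [e]; exact div_nonneg (by linarith) (by positivity)
  have h5 : ξ / (1 + ξ) ≤ 1 := (div_le_one (by positivity)).2 (by linarith)
  have h6 : s / (1 + s) ≤ 1 := (div_le_one (by positivity)).2 (by linarith)
  have h7 : (ξ / (1 + ξ)) ^ 2 ≤ (s / (1 + s)) ^ 2 + 2 * (t - s) := by
    nlinarith
  nlinarith

lemma errVar_sub_le_bounded (hR : ∀ᵐ x ∂ν, ‖x‖ ≤ R) {a b : ℝ} (ha : 0 < a) (hab : a ≤ b) :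
    errVar ν (1 / Real.sqrt b) - errVar ν (1 / Real.sqrt a) ≤ ((n : ℝ) ^ 2 + 2 * n) * (b - a) := by
  have := errVar_sub_le_of_bounded hR ha hab (Ψ := fun t => ((n : ℝ) ^ 2 + 2 * n) * t) (L := 0)
    (fun s t hs hst => by
      have h1 : covEnergy ν s ≤ (n : ℝ) ^ 2 + 2 * n := by
        refine (covEnergy_le (ha.trans_le hs)).trans ?_
        linarith [sq_nonneg ((n : ℝ) - (1 / Real.sqrt s) ^ 2 * errVar ν (1 / Real.sqrt s))]
      have := mul_le_mul_of_nonneg_left h1 (sub_nonneg.2 hst)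
      linarith)
  linarith

lemma errVar_sub_le_bounded_of_power (hR : ∀ᵐ x ∂ν, ‖x‖ ≤ R) (h2 : MemLp (fun x => x) 2 ν)
    (hp : ∫ x, ‖x‖ ^ 2 ∂ν ≤ n) {a b : ℝ} (ha : 0 < a) (hab : a ≤ b) :
    errVar ν (1 / Real.sqrt b) - errVar ν (1 / Real.sqrt a)
      ≤ ((n : ℝ) ^ 2 + 2 * n) * (b - a) - n * (gainFun b - gainFun a) := by
  have := errVar_sub_le_of_bounded hR ha hab
    (Ψ := fun t => ((n : ℝ) ^ 2 + 2 * n) * t - n * gainFun t) (L := 2 * n)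
    (fun s t hs hst => by
      have h1 := mul_le_mul_of_nonneg_left (covEnergy_le_of_power (ha.trans_le hs) h2 hp)
        (sub_nonneg.2 hst)
      have h3 := mul_le_mul_of_nonneg_left (gainFun_sub_le (ha.trans_le hs) hst)
        (n.cast_nonneg : (0 : ℝ) ≤ n)
      linarith)
  linarith

end Growth

section Truncation

open Filter

/-! ### Truncation of the input -/

/-- Truncation of a vector to a ball. -/
def trunc (k : ℕ) (x : Euc n) : Euc n := (Metric.closedBall (0 : Euc n) k).indicator id x

lemma measurable_trunc (k : ℕ) : Measurable (trunc (n := n) k) :=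
  measurable_id.indicator Metric.isClosed_closedBall.measurableSet

/-- Far points go to the origin, not to the sphere; this alternative makes domination uniform in k
immediate. -/
lemma trunc_eq_or (k : ℕ) (x : Euc n) : trunc k x = x ∨ trunc k x = 0 := by
  by_cases h : x ∈ Metric.closedBall (0 : Euc n) k
  · exact Or.inl (Set.indicator_of_mem h _)
  · exact Or.inr (Set.indicator_of_notMem h _)

lemma norm_trunc_le (k : ℕ) (x : Euc n) : ‖trunc k x‖ ≤ k := by
  by_cases h : x ∈ Metric.closedBall (0 : Euc n) k
  · rw [trunc, Set.indicator_of_mem h]; simpa using h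
  · rw [trunc, Set.indicator_of_notMem h]; simp

lemma norm_trunc_le_norm (k : ℕ) (x : Euc n) : ‖trunc k x‖ ≤ ‖x‖ := by
  rcases trunc_eq_or k x with h | h <;> simp [h]

lemma eventually_trunc_eq (x : Euc n) : ∀ᶠ k in atTop, trunc k x = x := by
  filter_upwards [eventually_ge_atTop ⌈‖x‖⌉₊] with k hk
  refine Set.indicator_of_mem ?_ _
  simpa using Nat.ceil_le.1 hk

variable {ν : Measure (Euc n)} [IsProbabilityMeasure ν] {c : ℝ}

instance (k : ℕ) : IsProbabilityMeasure (ν.map (trunc k)) :=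
  Measure.isProbabilityMeasure_map (measurable_trunc k).aemeasurable

/-- The unnormalized posterior mean of the noise. -/
def noiseMoment (ν : Measure (Euc n)) (c : ℝ) (y : Euc n) : Euc n :=
  ∫ x, tilt c x y • (y - c • x) ∂ν

lemma noiseMoment_eq (hc : c ≠ 0) (y : Euc n) :
    y - c • postMean ν c y = (outDensity ν c y)⁻¹ • noiseMoment ν c y := by
  rw [← integral_noise hc, integral_posterior, noiseMoment]

/-- The integral is taken against pure noise, which does not depend on ν, so dominated convergence
applies when ν varies. -/
lemma sq_mul_errVar_eq (hc : c ≠ 0) :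
    c ^ 2 * errVar ν c
      = n - ∫ y, ‖noiseMoment ν c y‖ ^ 2 / outDensity ν c y ∂(stdG n) := by
  rw [sq_mul_errVar hc, outLaw_eq_withDensity, integral_withDensity_eq_integral_toReal_smul
    (measurable_outDensity ν c).ennreal_ofReal (by simp)]
  congr 2 with y
  have hP := outDensity_pos ν c y
  rw [ENNReal.toReal_ofReal hP.le, noiseMoment_eq hc, norm_smul, mul_pow, norm_inv,
    Real.norm_of_nonneg hP.le, smul_eq_mul]
  field_simp

/-- Cauchy-Schwarz, in the form of nonnegativity of the posterior variance multiplied by the output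
density. -/
lemma noiseMoment_sq_div_le (hc : c ≠ 0) (y : Euc n) :
    ‖noiseMoment ν c y‖ ^ 2 / outDensity ν c y ≤ ∫ x, ‖y - c • x‖ ^ 2 * tilt c x y ∂ν := by
  have hP := outDensity_pos ν c y
  have h := mul_nonneg (sq_nonneg c) (postVar_nonneg (ν := ν) (c := c) y)
  rw [sq_mul_postVar hc, noiseMoment_eq hc, integral_posterior, norm_smul, mul_pow, norm_inv,
    Real.norm_of_nonneg hP.le, smul_eq_mul] at h
  simp only [smul_eq_mul, mul_comm (tilt c _ y)] at h
  set I := ∫ x, ‖y - c • x‖ ^ 2 * tilt c x y ∂ν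
  have h2 : 0 ≤ outDensity ν c y * ((outDensity ν c y)⁻¹ * I
      - (outDensity ν c y)⁻¹ ^ 2 * ‖noiseMoment ν c y‖ ^ 2) := mul_nonneg hP.le h
  have e : outDensity ν c y * ((outDensity ν c y)⁻¹ * I
      - (outDensity ν c y)⁻¹ ^ 2 * ‖noiseMoment ν c y‖ ^ 2)
      = I - ‖noiseMoment ν c y‖ ^ 2 / outDensity ν c y := by
    field_simp
  linarith

lemma integrable_noise_energy (ν : Measure (Euc n)) [IsProbabilityMeasure ν] (c : ℝ) :
    Integrable (fun y => ∫ x, ‖y - c • x‖ ^ 2 * tilt c x y ∂ν) (stdG n) := by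
  have h := integrable_integral_noise_pow ν c 2
  rw [outLaw_eq_withDensity, integrable_withDensity_iff_integrable_smul'
    (measurable_outDensity ν c).ennreal_ofReal (by simp)] at h
  refine h.congr (Eventually.of_forall fun y => ?_)
  have hP := outDensity_pos ν c y
  simp only
  rw [ENNReal.toReal_ofReal hP.le, integral_posterior, smul_smul, mul_inv_cancel₀ hP.ne', one_smul]
  simp [mul_comm]

lemma continuous_tilt_left (c : ℝ) (y : Euc n) : Continuous fun x : Euc n => tilt c x y := by
  unfold tilt; fun_prop

lemma stronglyMeasurable_noiseMoment : StronglyMeasurable (noiseMoment ν c) := by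
  have h : StronglyMeasurable fun p : Euc n × Euc n => tilt c p.2 p.1 • (p.1 - c • p.2) :=
    Continuous.stronglyMeasurable (((continuous_tilt c).comp continuous_swap).smul (by fun_prop))
  exact h.integral_prod_right

lemma outDensity_map_trunc {ν : Measure (Euc n)} (k : ℕ) (y : Euc n) :
    outDensity (ν.map (trunc k)) c y = ∫ x, tilt c (trunc k x) y ∂ν := by
  rw [outDensity, integral_map (measurable_trunc k).aemeasurable
    (continuous_tilt_left c y).aestronglyMeasurable]

lemma noiseMoment_map_trunc {ν : Measure (Euc n)} (k : ℕ) (y : Euc n) :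
    noiseMoment (ν.map (trunc k)) c y
      = ∫ x, tilt c (trunc k x) y • (y - c • trunc k x) ∂ν := by
  rw [noiseMoment, integral_map (measurable_trunc k).aemeasurable]
  exact ((continuous_tilt_left c y).smul (by fun_prop)).aestronglyMeasurable

lemma tendsto_outDensity_map_trunc (y : Euc n) :
    Tendsto (fun k => outDensity (ν.map (trunc k)) c y) atTop (𝓝 (outDensity ν c y)) := by
  simp_rw [outDensity_map_trunc]
  refine tendsto_integral_of_dominated_convergence
    (fun _ => (Nat.factorial 0) * Real.exp (1 / 2) * Real.exp (‖y‖ ^ 2 / 2)) (fun k => ?_)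
    (integrable_const _) (fun k => Eventually.of_forall fun x => ?_)
    (Eventually.of_forall fun x => ?_)
  · exact ((measurable_tilt_left c y).comp (measurable_trunc k)).aestronglyMeasurable
  · rw [Real.norm_of_nonneg (tilt_pos _ _ _).le]
    simpa using norm_pow_mul_tilt_le 0 c (trunc k x) y
  · refine tendsto_const_nhds.congr' ?_
    filter_upwards [eventually_trunc_eq x] with k hk
    rw [hk]

lemma tendsto_noiseMoment_map_trunc (y : Euc n) :
    Tendsto (fun k => noiseMoment (ν.map (trunc k)) c y) atTop (𝓝 (noiseMoment ν c y)) := by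
  simp_rw [noiseMoment_map_trunc]
  refine tendsto_integral_of_dominated_convergence
    (fun _ => (Nat.factorial 1) * Real.exp (1 / 2) * Real.exp (‖y‖ ^ 2 / 2)) (fun k => ?_)
    (integrable_const _) (fun k => Eventually.of_forall fun x => ?_)
    (Eventually.of_forall fun x => ?_)
  · exact (((measurable_tilt_left c y).comp (measurable_trunc k)).smul (measurable_const.sub
      ((measurable_trunc k).const_smul c))).aestronglyMeasurable
  · rw [norm_smul, Real.norm_of_nonneg (tilt_pos _ _ _).le, mul_comm]
    simpa using norm_pow_mul_tilt_le 1 c (trunc k x) y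
  · refine tendsto_const_nhds.congr' ?_
    filter_upwards [eventually_trunc_eq x] with k hk
    rw [hk]

/-- A truncated point is x itself or 0, and at 0 the likelihood is 1 and the integrand ‖y‖^2. The
resulting bound does not depend on k. -/
lemma noise_energy_map_trunc_le (k : ℕ) (y : Euc n) :
    ∫ x, ‖y - c • x‖ ^ 2 * tilt c x y ∂(ν.map (trunc k))
      ≤ ∫ x, ‖y - c • x‖ ^ 2 * tilt c x y ∂ν + ‖y‖ ^ 2 := by
  have hcont : Continuous fun x : Euc n => ‖y - c • x‖ ^ 2 * tilt c x y :=
    Continuous.mul (by fun_prop) (continuous_tilt_left c y)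
  have hi := integrable_norm_pow_mul_tilt ν 2 c y
  have hik := integrable_norm_pow_mul_tilt (ν.map (trunc k)) 2 c y
  rw [integral_map (measurable_trunc k).aemeasurable hcont.aestronglyMeasurable]
  have : ∫ x, ‖y - c • x‖ ^ 2 * tilt c x y ∂ν + ‖y‖ ^ 2
      = ∫ x, (‖y - c • x‖ ^ 2 * tilt c x y + ‖y‖ ^ 2) ∂ν := by
    rw [integral_add hi (integrable_const _)]; simp
  rw [this]
  refine integral_mono ?_ (hi.add (integrable_const _)) fun x => ?_
  · exact (integrable_map_measure hcont.aestronglyMeasurable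
      (measurable_trunc k).aemeasurable).1 hik
  · simp only
    rcases trunc_eq_or k x with h | h <;> rw [h]
    · linarith [sq_nonneg ‖y‖]
    · have h1 : 0 ≤ ‖y - c • x‖ ^ 2 * tilt c x y := mul_nonneg (by positivity) (tilt_pos _ _ _).le
      simpa [tilt] using h1

/-- The error variance of the truncated input converges to the error variance. -/
lemma tendsto_errVar_map_trunc (hc : c ≠ 0) :
    Tendsto (fun k => errVar (ν.map (trunc k)) c) atTop (𝓝 (errVar ν c)) := by
  have hc2 : c ^ 2 ≠ 0 := pow_ne_zero 2 hc
  have h : ∀ (ρ : Measure (Euc n)) [IsProbabilityMeasure ρ], errVar ρ c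
      = (c ^ 2)⁻¹ * (n - ∫ y, ‖noiseMoment ρ c y‖ ^ 2 / outDensity ρ c y ∂(stdG n)) := by
    intro ρ _
    rw [← sq_mul_errVar_eq hc, inv_mul_cancel_left₀ hc2]
  rw [h ν]
  simp_rw [fun k => h (ν.map (trunc k))]
  refine (tendsto_const_nhds.sub ?_).const_mul _
  refine tendsto_integral_of_dominated_convergence
    (fun y => ∫ x, ‖y - c • x‖ ^ 2 * tilt c x y ∂ν + ‖y‖ ^ 2) (fun k => ?_)
    ((integrable_noise_energy ν c).add (integrable_norm_pow_stdG 2))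
    (fun k => Eventually.of_forall fun y => ?_) (Eventually.of_forall fun y => ?_)
  · exact ((stronglyMeasurable_noiseMoment.measurable.norm.pow_const 2).div
      (measurable_outDensity _ c)).aestronglyMeasurable
  · rw [Real.norm_of_nonneg (div_nonneg (by positivity) (outDensity_pos _ c y).le)]
    exact (noiseMoment_sq_div_le hc y).trans (noise_energy_map_trunc_le k y)
  · exact ((tendsto_noiseMoment_map_trunc y).norm.pow 2).div (tendsto_outDensity_map_trunc y)
      (outDensity_pos ν c y).ne'

lemma ae_norm_le_map_trunc {ν : Measure (Euc n)} (k : ℕ) : ∀ᵐ x ∂(ν.map (trunc k)), ‖x‖ ≤ k := by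
  rw [ae_map_iff (measurable_trunc k).aemeasurable
    (measurableSet_le measurable_norm measurable_const)]
  exact Eventually.of_forall fun x => norm_trunc_le k x

lemma integral_norm_sq_map_trunc_le {ν : Measure (Euc n)} (h2 : MemLp (fun x => x) 2 ν) (k : ℕ) :
    ∫ x, ‖x‖ ^ 2 ∂(ν.map (trunc k)) ≤ ∫ x, ‖x‖ ^ 2 ∂ν := by
  rw [integral_map (measurable_trunc k).aemeasurable (by fun_prop)]
  refine integral_mono_of_nonneg (Eventually.of_forall fun x => by positivity)
    (h2.integrable_norm_pow two_ne_zero) (Eventually.of_forall fun x => ?_)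
  have := norm_trunc_le_norm k x
  simp only
  gcongr

/-- The growth of the error variance in terms of the noise variance. -/
theorem errVar_sub_le {a b : ℝ} (ha : 0 < a) (hab : a ≤ b) :
    errVar ν (1 / Real.sqrt b) - errVar ν (1 / Real.sqrt a) ≤ ((n : ℝ) ^ 2 + 2 * n) * (b - a) := by
  have hb : 0 < b := ha.trans_le hab
  refine le_of_tendsto'
    ((tendsto_errVar_map_trunc (one_div_pos.2 (Real.sqrt_pos.2 hb)).ne').sub
      (tendsto_errVar_map_trunc (one_div_pos.2 (Real.sqrt_pos.2 ha)).ne')) fun k => ?_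
  exact errVar_sub_le_bounded (ae_norm_le_map_trunc k) ha hab

/-- The growth of the error variance in terms of the noise variance, under a power constraint. -/
theorem errVar_sub_le_of_power (h2 : MemLp (fun x => x) 2 ν) (hp : ∫ x, ‖x‖ ^ 2 ∂ν ≤ n)
    {a b : ℝ} (ha : 0 < a) (hab : a ≤ b) :
    errVar ν (1 / Real.sqrt b) - errVar ν (1 / Real.sqrt a)
      ≤ ((n : ℝ) ^ 2 + 2 * n) * (b - a) - n * (gainFun b - gainFun a) := by
  have hb : 0 < b := ha.trans_le hab
  refine le_of_tendsto'
    ((tendsto_errVar_map_trunc (one_div_pos.2 (Real.sqrt_pos.2 hb)).ne').sub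
      (tendsto_errVar_map_trunc (one_div_pos.2 (Real.sqrt_pos.2 ha)).ne')) fun k => ?_
  have hk := ae_norm_le_map_trunc (ν := ν) k
  exact errVar_sub_le_bounded_of_power hk (MemLp.of_bound (by fun_prop) k hk)
    ((integral_norm_sq_map_trunc_le h2 k).trans hp) ha hab

end Truncation

section Channel

/-! ### The minimum mean squared error of the channel -/

section Mmse

variable {Ω : Type*} {mΩ : MeasurableSpace Ω} {μ : Measure Ω} [IsProbabilityMeasure μ]
  {X Z : Ω → Euc n} {snr : ℝ}

lemma isProbabilityMeasure_map_of_measurable (hX : Measurable X) : IsProbabilityMeasure (μ.map X) :=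
  Measure.isProbabilityMeasure_map hX.aemeasurable

lemma map_prodMk_channel (hX : Measurable X) (hZ : HasLaw Z (stdG n) μ) (hXZ : IndepFun X Z μ) :
    μ.map (fun ω => (X ω, Z ω)) = (μ.map X).prod (stdG n) := by
  rw [(indepFun_iff_map_prod_eq_prod_map_map hX.aemeasurable hZ.aemeasurable).1 hXZ, hZ.map_eq]

lemma aemeasurable_channelOutput {μ : Measure Ω} (hX : Measurable X) (hZ : HasLaw Z (stdG n) μ) :
    AEMeasurable (channelOutput X Z snr) μ := by
  have h : Measurable fun p : Euc n × Euc n => Real.sqrt snr • p.1 + p.2 := by fun_prop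
  exact h.comp_aemeasurable (hX.aemeasurable.prodMk hZ.aemeasurable)

lemma map_channelOutput (hX : Measurable X) (hZ : HasLaw Z (stdG n) μ) (hXZ : IndepFun X Z μ) :
    μ.map (channelOutput X Z snr) = outLaw (μ.map X) (Real.sqrt snr) := by
  have hZm := hZ.aemeasurable
  rw [outLaw, ← map_prodMk_channel hX hZ hXZ,
    AEMeasurable.map_map_of_aemeasurable (by fun_prop) (hX.aemeasurable.prodMk hZm)]
  rfl

/-- Bayes' rule exhibits `posterior` as a disintegration of the joint law, and disintegrations are
almost everywhere unique. -/
lemma condDistrib_channel [IsProbabilityMeasure (μ.map X)] (hX : Measurable X)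
    (hZ : HasLaw Z (stdG n) μ) (hXZ : IndepFun X Z μ) :
    ∀ᵐ ω ∂μ, condDistrib X (channelOutput X Z snr) μ (channelOutput X Z snr ω)
      = posterior (μ.map X) (Real.sqrt snr) (channelOutput X Z snr ω) := by
  have hY := aemeasurable_channelOutput (snr := snr) hX hZ
  refine ae_of_ae_map hY (condDistrib_ae_eq_of_measure_eq_compProd _ hX.aemeasurable ?_)
  rw [map_channelOutput hX hZ hXZ, outLaw_compProd_posterior, ← map_prodMk_channel hX hZ hXZ,
    AEMeasurable.map_map_of_aemeasurable (by fun_prop) (hX.aemeasurable.prodMk hZ.aemeasurable)]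
  rfl

lemma condCov_channel [IsProbabilityMeasure (μ.map X)] (hX : Measurable X)
    (hZ : HasLaw Z (stdG n) μ) (hXZ : IndepFun X Z μ) (i j : Fin n) :
    (fun ω => condCov X (channelOutput X Z snr) μ (channelOutput X Z snr ω) i j)
      =ᵐ[μ] fun ω => postCov (μ.map X) (Real.sqrt snr) (channelOutput X Z snr ω) i j := by
  filter_upwards [condDistrib_channel (snr := snr) hX hZ hXZ] with ω hω
  simp only [condCov, condMean, Matrix.of_apply, hω]
  rfl

lemma integrable_condCov_channel [IsProbabilityMeasure (μ.map X)] (hX : Measurable X)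
    (hZ : HasLaw Z (stdG n) μ) (hXZ : IndepFun X Z μ) (hs : 0 < snr) (i j : Fin n) :
    Integrable (fun ω => condCov X (channelOutput X Z snr) μ (channelOutput X Z snr ω) i j) μ := by
  refine Integrable.congr ?_ (condCov_channel hX hZ hXZ i j).symm
  have h := integrable_postCov (ν := μ.map X) (Real.sqrt_pos.2 hs).ne' i j
  rw [← map_channelOutput hX hZ hXZ] at h
  exact h.comp_aemeasurable (aemeasurable_channelOutput hX hZ)

lemma mmseWellDefined_channel (hX : Measurable X)
    (hZ : HasLaw Z (stdG n) μ) (hXZ : IndepFun X Z μ) (hs : 0 < snr) :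
    MmseWellDefined X (channelOutput X Z snr) μ := by
  have := isProbabilityMeasure_map_of_measurable (μ := μ) hX
  refine ⟨?_, integrable_condCov_channel hX hZ hXZ hs⟩
  filter_upwards [condDistrib_channel (snr := snr) hX hZ hXZ] with ω hω
  rw [hω]
  exact memLp_posterior (μ.map X) (Real.sqrt_pos.2 hs).ne' 2 _

lemma mmse_channel [IsProbabilityMeasure (μ.map X)] (hX : Measurable X)
    (hZ : HasLaw Z (stdG n) μ) (hXZ : IndepFun X Z μ) (hs : 0 < snr) :
    mmse X (channelOutput X Z snr) μ = 1 / n * errVar (μ.map X) (Real.sqrt snr) := by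
  have hc := (Real.sqrt_pos.2 hs).ne'
  have hY := aemeasurable_channelOutput (snr := snr) hX hZ
  rw [mmse, errVar]
  congr 1
  simp_rw [postVar_eq_sum hc]
  rw [integral_finsetSum _ fun i _ => integrable_postCov hc i i, Matrix.trace]
  refine Finset.sum_congr rfl fun i _ => ?_
  rw [Matrix.diag_apply, expMatrix, Matrix.of_apply, integral_congr_ae (condCov_channel hX hZ hXZ i i),
    ← map_channelOutput hX hZ hXZ, integral_map hY
    (stronglyMeasurable_postCov _ _ i i).aestronglyMeasurable]

lemma PowerConstraint.integral_norm_sq_le (hn : 0 < n) (hX : Measurable X)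
    (h : PowerConstraint X μ) :
    MemLp (fun x => x) 2 (μ.map X) ∧ ∫ x, ‖x‖ ^ 2 ∂(μ.map X) ≤ n := by
  obtain ⟨h2, hp⟩ := h
  refine ⟨(memLp_map_measure_iff (by fun_prop) hX.aemeasurable).2 h2, ?_⟩
  have hn' : (0 : ℝ) < n := by exact_mod_cast hn
  rw [integral_map hX.aemeasurable (by fun_prop)]
  rw [one_div, inv_mul_eq_div, div_le_one hn'] at hp
  refine le_of_eq_of_le ?_ hp
  simp_rw [EuclideanSpace.real_norm_sq_eq, Matrix.trace, Matrix.diag_apply, expMatrix,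
    Matrix.of_apply, Matrix.vecMulVec_apply, sq]
  refine integral_finsetSum _ fun i _ => ?_
  simpa using integrable_mul_coord h2 0 i i

end Mmse

/-! ### The gain as an integral over the signal-to-noise ratio -/

lemma gainFun_one_div {γ : ℝ} (hγ : 0 < γ) :
    gainFun (1 / γ) = 1 / γ - 2 * (Real.log (1 + γ) - Real.log γ) - (1 - 1 / (1 + γ)) := by
  rw [gainFun, ← Real.log_div (by positivity) hγ.ne']
  congr 2
  · congr 2; field_simp; ring
  · field_simp; ring

lemma gainFun_sub_eq {s s₀ : ℝ} (hs : 0 < s) (hs₀ : 0 < s₀) :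
    gainFun (1 / s) - gainFun (1 / s₀)
      = 2 * Real.log ((1 + s₀) / (1 + s)) - 2 * Real.log (s₀ / s)
        + 1 / (1 + s) - 1 / (1 + s₀) + 1 / s - 1 / s₀ := by
  rw [gainFun_one_div hs, gainFun_one_div hs₀, Real.log_div (by positivity) (by positivity),
    Real.log_div hs₀.ne' hs.ne']
  ring

/-- Substitution t = 1/γ: there t/(1+t) = 1/(1+γ), and dt contributes the factor 1/γ^2. -/
lemma integral_gain {s s₀ : ℝ} (hs : 0 < s) (hss : s ≤ s₀) :
    ∫ γ in s..s₀, 1 / (γ ^ 2 * (1 + γ) ^ 2) = gainFun (1 / s) - gainFun (1 / s₀) := by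
  have hpos : ∀ γ ∈ Set.uIcc s s₀, 0 < γ := fun γ hγ => by
    rw [Set.uIcc_of_le hss] at hγ
    exact hs.trans_le hγ.1
  have hd : ∀ γ ∈ Set.uIcc s s₀,
      HasDerivAt (fun γ => -gainFun (1 / γ)) (1 / (γ ^ 2 * (1 + γ) ^ 2)) γ := by
    intro γ hγ
    have h0 := hpos γ hγ
    have h1 : HasDerivAt (fun γ : ℝ => 1 / γ) (-(γ ^ 2)⁻¹) γ := by
      simpa using hasDerivAt_inv h0.ne'
    have h2 := ((hasDerivAt_gainFun (one_div_pos.2 h0)).comp γ h1).neg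
    refine h2.congr_deriv ?_
    field_simp
    ring
  rw [intervalIntegral.integral_eq_sub_of_hasDerivAt hd]
  · ring
  · refine ContinuousOn.intervalIntegrable fun γ hγ => ContinuousAt.continuousWithinAt ?_
    have h0 := hpos γ hγ
    exact ContinuousAt.div (by fun_prop) (by fun_prop) (by positivity)

lemma sqrt_eq_one_div_sqrt {s : ℝ} : Real.sqrt s = 1 / Real.sqrt (1 / s) := by
  rw [one_div s, Real.sqrt_inv, one_div, inv_inv]

end Channel

end DBound

end

/-! ### Normalisation by the dimension and return to the signal-to-noise ratio. -/

theorem mainTheorem1 (n : ℕ) (hn : 0 < n) :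
    ∃ k : ℝ, k ≤ (n : ℝ) + 2 ∧
      ∀ {Ω : Type*} [MeasurableSpace Ω] (μ : Measure Ω) [IsProbabilityMeasure μ]
        (X Z Z₀ : Ω → EuclideanSpace ℝ (Fin n)) (snr snr₀ β : ℝ),
        Measurable X →
        HasLaw Z (stdGaussian (EuclideanSpace ℝ (Fin n))) μ →
        HasLaw Z₀ (stdGaussian (EuclideanSpace ℝ (Fin n))) μ →
        IndepFun X Z μ → IndepFun X Z₀ μ →
        0 < snr → snr ≤ snr₀ → 0 ≤ β →
        DBound.mmse X (DBound.channelOutput X Z₀ snr₀) μ = β / (1 + β * snr₀) →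
        (DBound.MmseWellDefined X (DBound.channelOutput X Z snr) μ ∧
          DBound.MmseWellDefined X (DBound.channelOutput X Z₀ snr₀) μ) ∧
        DBound.mmse X (DBound.channelOutput X Z snr) μ
          ≤ DBound.mmse X (DBound.channelOutput X Z₀ snr₀) μ + k * (1 / snr - 1 / snr₀) ∧
        (DBound.PowerConstraint X μ →
          DBound.mmse X (DBound.channelOutput X Z snr) μ
            ≤ DBound.mmse X (DBound.channelOutput X Z₀ snr₀) μ + k * (1 / snr - 1 / snr₀)
              - ∫ γ in snr..snr₀, 1 / (γ ^ 2 * (1 + γ) ^ 2)) ∧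
        ∫ γ in snr..snr₀, 1 / (γ ^ 2 * (1 + γ) ^ 2)
          = 2 * Real.log ((1 + snr₀) / (1 + snr)) - 2 * Real.log (snr₀ / snr)
            + 1 / (1 + snr) - 1 / (1 + snr₀) + 1 / snr - 1 / snr₀ := by
  have hn' : (0 : ℝ) < n := by exact_mod_cast hn
  -- The constant is E‖Z‖^4 / n = (n^2 + 2n)/n, the same for both bounds.
  refine ⟨(n : ℝ) + 2, le_rfl, ?_⟩
  intro Ω _ μ _ X Z Z₀ snr snr₀ β hX hZ hZ₀ hXZ hXZ₀ hs hss _ _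
  have hs₀ : 0 < snr₀ := hs.trans_le hss
  have := DBound.isProbabilityMeasure_map_of_measurable (μ := μ) hX
  have hab : 1 / snr₀ ≤ 1 / snr := one_div_le_one_div_of_le hs hss
  rw [DBound.integral_gain hs hss, DBound.mmse_channel hX hZ hXZ hs,
    DBound.mmse_channel hX hZ₀ hXZ₀ hs₀, DBound.sqrt_eq_one_div_sqrt (s := snr),
    DBound.sqrt_eq_one_div_sqrt (s := snr₀)]
  refine ⟨⟨DBound.mmseWellDefined_channel hX hZ hXZ hs,
    DBound.mmseWellDefined_channel hX hZ₀ hXZ₀ hs₀⟩, ?_, fun hp => ?_,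
    DBound.gainFun_sub_eq hs hs₀⟩
  · have h := DBound.errVar_sub_le (ν := μ.map X) (one_div_pos.2 hs₀) hab
    have h1 := mul_le_mul_of_nonneg_left h (one_div_pos.2 hn').le
    have e : 1 / (n : ℝ) * (((n : ℝ) ^ 2 + 2 * n) * (1 / snr - 1 / snr₀))
        = (n + 2) * (1 / snr - 1 / snr₀) := by field_simp
    linarith
  · obtain ⟨h2, hp2⟩ := hp.integral_norm_sq_le hn hX
    have h := DBound.errVar_sub_le_of_power h2 hp2 (one_div_pos.2 hs₀) hab
    have h1 := mul_le_mul_of_nonneg_left h (one_div_pos.2 hn').le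
    have e : 1 / (n : ℝ) * (((n : ℝ) ^ 2 + 2 * n) * (1 / snr - 1 / snr₀)
        - n * (DBound.gainFun (1 / snr) - DBound.gainFun (1 / snr₀)))
        = (n + 2) * (1 / snr - 1 / snr₀)
          - (DBound.gainFun (1 / snr) - DBound.gainFun (1 / snr₀)) := by field_simp
    linarith
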